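/- Let $m>0$ and let $\alpha_1,\alpha_2,\alpha_3,\beta$ be $4\times4$ Dirac matrices, i.e. Hermitian complex matrices with $\alpha_j\alpha_k+\alpha_k\alpha_j=2\delta_{jk}$, $\alpha_j\beta+\beta\alpha_j=0$, $\beta^2=1$. Let $D_m=-i\alpha\cdot\nabla+m\beta$ on $\mathbb R^3$, and let $D_m^{-1}$ be its bounded inverse on $L^2(\mathbb R^3;\mathbb C^4)$ (the Fourier multiplier by the inverse of the symbol of $D_m$). For $\varepsilon>0$ let $K_m^\varepsilon=(-\Delta+m^2)^{-\varepsilon}$, defined pointwise by $$(K_m^\varepsilon\psi)(x)=\frac1{(2\pi)^3}\int_{\mathbb R^3}e^{-i\xi\cdot x}\,\frac{\hat\psi(\xi)}{(|\xi|^2+m^2)^{\varepsilon}}\,d^3\xi ,\qquad \hat\psi(\xi)=\int_{\mathbb R^3} e^{i\xi\cdot x}\psi(x)\,d^3x ,$$ where for $\psi\in L^2$ the transform $\hat\psi$ is the $L^2$ Fourier transform. Let $J_0,J_1$ be the Bessel functions of the first kind, let $\theta$ be the Heaviside function, and for $\zeta:[0,\infty)\to\mathbb C^4$ put $$p_S(x,t)=\frac{\theta(t-|x|)\,\dot\zeta(t-|x|)}{4\pi|x|}-\frac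 m{4\pi}\int_0^t\frac{\theta(s-|x|)\,J_1\!\big(m\sqrt{s^2-|x|^2}\big)}{\sqrt{s^2-|x|^2}}\,\dot\zeta(t-s)\,ds .$$ **Proposition.** Let $\zeta\in C^1([0,\infty);\mathbb C^4)$ with $\ddot\zeta\in L^2_{\rm loc}([0,\infty);\mathbb C^4)$ (that is, $\dot\zeta$ is locally absolutely continuous on $[0,\infty)$ with derivative in $L^2([0,T])$ for every $T>0$), and write $\zeta_0=\zeta(0)$. Then for every $t>0$ the following holds. The function $u\mapsto J_1(u)/u$ is integrable on $(0,\infty)$. The function $p_S(\cdot,t)$ belongs to $L^2(\mathbb R^3;\mathbb C^4)$. For every $\varepsilon>0$ the integral that defines $K_m^\varepsilon D_m^{-1}p_S(x,t)$ converges absolutely, and the limit $\lim_{x\to0}K_m^\varepsilon D_m^{-1}p_S(x,t)$ exists. Finally, the iterated limit exists, with $$\lim_{\varepsilon\to0+}\ \lim_{x\to0}K_m^{\varepsilon}D_m^{-1}p_S(x,t)=\frac{m\beta}{4\pi}\Big(\zeta_0\Big[mt\int_{mt}^{\infty}\frac{J_1(u)}{u}\,du-J_0(mt)\Big]+\zeta(t)-m\int_0^t\Big(\int_{ms}^{\infty}\frac{J_1(u)}{u}\,du\Big)\zeta(t-s)\,ds\Big).$$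 -/

import Mathlib

open MeasureTheory Filter Topology Set
open scoped FourierTransform Real Nat

noncomputable section

/-- Physical space `ℝ³`. -/
abbrev Space3 : Type := EuclideanSpace ℝ (Fin 3)

/-- The space `ℂ⁴` of spinors. -/
abbrev Spinor : Type := EuclideanSpace ℂ (Fin 4)

/-- `L²(ℝ³; ℂ⁴)`. -/
abbrev L2Spinor : Type := Lp Spinor 2 (volume : Measure Space3)

/-- The action of a complex `4 × 4` matrix on spinors. -/
def matAct (A : Matrix (Fin 4) (Fin 4) ℂ) : Spinor →L[ℂ] Spinor :=
  Matrix.toEuclideanCLM (n := Fin 4) (𝕜 := ℂ) A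

/-- `α₁, α₂, α₃, β` are `4 × 4` Dirac matrices: Hermitian matrices that satisfy
`αⱼ αₖ + αₖ αⱼ = 2 δⱼₖ`, `αⱼ β + β αⱼ = 0` and `β² = 1`. -/
structure IsDiracMatrices (α : Fin 3 → Matrix (Fin 4) (Fin 4) ℂ)
    (β : Matrix (Fin 4) (Fin 4) ℂ) : Prop where
  alpha_herm : ∀ j, (α j).IsHermitian
  beta_herm : β.IsHermitian
  alpha_anticomm : ∀ j k, α j * α k + α k * α j = if j = k then 2 else 0
  alpha_beta : ∀ j, α j * β + β * α j = 0
  beta_sq : β * β = 1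

/-- The symbol of `D_m = -i α·∇ + m β`. The Fourier transform of Mathlib uses the
characters `exp(2πi ⟨ξ, x⟩)`, so `-i ∂ₖ` becomes multiplication by `2π ξₖ`. -/
def diracSymbol (α : Fin 3 → Matrix (Fin 4) (Fin 4) ℂ) (β : Matrix (Fin 4) (Fin 4) ℂ)
    (m : ℝ) (ξ : Space3) : Matrix (Fin 4) (Fin 4) ℂ :=
  ∑ k, ((2 * π * ξ k : ℝ) : ℂ) • α k + (m : ℂ) • β

/-- The symbol of `-Δ + m²`, for the same normalisation of the Fourier transform. -/
def kgSymbol (m : ℝ) (ξ : Space3) : ℝ := (2 * π * ‖ξ‖) ^ 2 + m ^ 2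

theorem kgSymbol_pos {m : ℝ} (hm : 0 < m) (ξ : Space3) : 0 < kgSymbol m ξ := by
  unfold kgSymbol; positivity

theorem diracSymbol_mul_self {α : Fin 3 → Matrix (Fin 4) (Fin 4) ℂ}
    {β : Matrix (Fin 4) (Fin 4) ℂ} (hD : IsDiracMatrices α β) (m : ℝ) (ξ : Space3) :
    diracSymbol α β m ξ * diracSymbol α β m ξ = (kgSymbol m ξ : ℂ) • 1 := by
  have sq : ∀ j, α j * α j = 1 := by
    intro j
    have h := hD.alpha_anticomm j j
    rw [if_pos rfl, ← two_mul] at h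
    have h2 : (2 : ℂ) • (α j * α j) = (2 : ℂ) • (1 : Matrix (Fin 4) (Fin 4) ℂ) := by
      rw [two_smul, two_smul, ← two_mul, h, one_add_one_eq_two]
    exact smul_right_injective _ (two_ne_zero : (2 : ℂ) ≠ 0) h2
  have ac : ∀ j k, j ≠ k → α k * α j = -(α j * α k) := by
    intro j k hjk
    have h := hD.alpha_anticomm j k
    rw [if_neg hjk] at h
    exact eq_neg_of_add_eq_zero_right h
  have ab : ∀ j, β * α j = -(α j * β) := fun j => eq_neg_of_add_eq_zero_right (hD.alpha_beta j)
  have hn : ‖ξ‖ ^ 2 = ξ 0 ^ 2 + ξ 1 ^ 2 + ξ 2 ^ 2 := by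
    rw [EuclideanSpace.norm_sq_eq, Fin.sum_univ_three]; simp
  have hk : (kgSymbol m ξ : ℂ) = (2 * π * ξ 0 : ℝ) * (2 * π * ξ 0 : ℝ)
      + (2 * π * ξ 1 : ℝ) * (2 * π * ξ 1 : ℝ) + (2 * π * ξ 2 : ℝ) * (2 * π * ξ 2 : ℝ)
      + (m : ℂ) * m := by
    unfold kgSymbol
    rw [mul_pow, hn]; push_cast; ring
  rw [hk]
  unfold diracSymbol
  rw [Fin.sum_univ_three]
  simp only [mul_add, add_mul, smul_mul_assoc, mul_smul_comm, sq, hD.beta_sq, ab,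
    ac 0 1 (by decide), ac 0 2 (by decide), ac 1 2 (by decide), smul_neg]
  module

theorem diracSymbol_inv {α : Fin 3 → Matrix (Fin 4) (Fin 4) ℂ}
    {β : Matrix (Fin 4) (Fin 4) ℂ} (hD : IsDiracMatrices α β) {m : ℝ} (hm : 0 < m)
    (ξ : Space3) :
    (diracSymbol α β m ξ)⁻¹ = ((kgSymbol m ξ : ℂ)⁻¹) • diracSymbol α β m ξ := by
  refine Matrix.inv_eq_right_inv ?_
  have h : (kgSymbol m ξ : ℂ) ≠ 0 := by exact_mod_cast (kgSymbol_pos hm ξ).ne'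
  rw [mul_smul_comm, diracSymbol_mul_self hD, smul_smul, inv_mul_cancel₀ h, one_smul]

theorem memLp_diracSymbol_inv {α : Fin 3 → Matrix (Fin 4) (Fin 4) ℂ}
    {β : Matrix (Fin 4) (Fin 4) ℂ} (hD : IsDiracMatrices α β) {m : ℝ} (hm : 0 < m)
    (v : L2Spinor) :
    MemLp (fun ξ => matAct (diracSymbol α β m ξ)⁻¹ (v ξ)) 2 (volume : Measure Space3) := by
  have hS : Continuous fun ξ : Space3 => matAct (diracSymbol α β m ξ)⁻¹ := by
    have e : (fun ξ : Space3 => matAct (diracSymbol α β m ξ)⁻¹) = fun ξ =>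
        ((kgSymbol m ξ : ℂ)⁻¹) •
          (∑ k, ((2 * π * ξ k : ℝ) : ℂ) • matAct (α k) + (m : ℂ) • matAct β) := by
      funext ξ
      rw [diracSymbol_inv hD hm]
      simp only [matAct, diracSymbol, map_smul, map_add, map_sum]
    rw [e]
    have h1 : Continuous fun ξ : Space3 => ((kgSymbol m ξ : ℂ))⁻¹ := by
      refine Continuous.inv₀ ?_ ?_
      · unfold kgSymbol; fun_prop
      · intro ξ; exact_mod_cast (kgSymbol_pos hm ξ).ne'
    refine h1.smul ?_
    fun_prop
  set C : ℝ := (∑ k, ‖matAct (α k)‖ + ‖matAct β‖) / m with hC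
  have hb : ∀ ξ : Space3, ‖matAct (diracSymbol α β m ξ)⁻¹‖ ≤ C := by
    intro ξ
    have hpos := kgSymbol_pos hm ξ
    set w : ℝ := √(kgSymbol m ξ) with hw
    have hw2 : w * w = kgSymbol m ξ := Real.mul_self_sqrt hpos.le
    have hwm : m ≤ w := by
      apply Real.le_sqrt_of_sq_le
      unfold kgSymbol; nlinarith [sq_nonneg (2 * π * ‖ξ‖)]
    have hwx : ∀ k, |2 * π * ξ k| ≤ w := by
      intro k
      apply Real.le_sqrt_of_sq_le
      have h1 : |ξ k| ≤ ‖ξ‖ := by simpa using PiLp.norm_apply_le ξ k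
      have h2 : |2 * π * ξ k| ≤ 2 * π * ‖ξ‖ := by
        rw [abs_mul, abs_of_pos (by positivity : (0 : ℝ) < 2 * π)]; gcongr
      have h3 := pow_le_pow_left₀ (abs_nonneg _) h2 2
      unfold kgSymbol; nlinarith [sq_nonneg m]
    have hw0 : 0 < w := hm.trans_le hwm
    rw [diracSymbol_inv hD hm]
    have e : matAct (((kgSymbol m ξ : ℂ)⁻¹) • diracSymbol α β m ξ) = ((kgSymbol m ξ : ℂ)⁻¹) •
        (∑ k, ((2 * π * ξ k : ℝ) : ℂ) • matAct (α k) + (m : ℂ) • matAct β) := by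
      simp only [matAct, diracSymbol, map_smul, map_add, map_sum]
    rw [e, norm_smul, norm_inv, Complex.norm_real, Real.norm_of_nonneg hpos.le, ← hw2]
    have h4 : ‖∑ k, ((2 * π * ξ k : ℝ) : ℂ) • matAct (α k) + (m : ℂ) • matAct β‖
        ≤ w * (∑ k, ‖matAct (α k)‖ + ‖matAct β‖) := by
      rw [mul_add, Finset.mul_sum]
      refine (norm_add_le _ _).trans (add_le_add ((norm_sum_le _ _).trans
        (Finset.sum_le_sum fun k _ => ?_)) ?_)
      · rw [norm_smul, Complex.norm_real, Real.norm_eq_abs]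
        exact mul_le_mul_of_nonneg_right (hwx k) (norm_nonneg _)
      · rw [norm_smul, Complex.norm_real, Real.norm_of_nonneg hm.le]
        exact mul_le_mul_of_nonneg_right hwm (norm_nonneg _)
    have hA : 0 ≤ ∑ k, ‖matAct (α k)‖ + ‖matAct β‖ := by positivity
    calc (w * w)⁻¹ * _ ≤ (w * w)⁻¹ * (w * (∑ k, ‖matAct (α k)‖ + ‖matAct β‖)) := by gcongr
      _ = (∑ k, ‖matAct (α k)‖ + ‖matAct β‖) / w := by field_simp
      _ ≤ C := by rw [hC]; gcongr
  have hv := Lp.memLp v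
  refine MemLp.of_le_mul (c := C) hv ?_ (Eventually.of_forall fun ξ => ?_)
  · exact (isBoundedBilinearMap_apply (𝕜 := ℂ) (E := Spinor)
      (F := Spinor)).continuous.comp_aestronglyMeasurable
      (hS.aestronglyMeasurable.prodMk hv.1)
  · exact (ContinuousLinearMap.le_opNorm _ _).trans
      (mul_le_mul_of_nonneg_right (hb ξ) (norm_nonneg _))

/-- The bounded operator `D_m⁻¹` on `L²(ℝ³; ℂ⁴)`: on the Fourier side it is multiplication
by the inverse of the symbol of `D_m`. -/
def diracInv {α : Fin 3 → Matrix (Fin 4) (Fin 4) ℂ} {β : Matrix (Fin 4) (Fin 4) ℂ}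
    (hD : IsDiracMatrices α β) {m : ℝ} (hm : 0 < m) (u : L2Spinor) :
    L2Spinor :=
  𝓕⁻ ((memLp_diracSymbol_inv hD hm (𝓕 u)).toLp _)

/-- The function `(|2πξ|² + m²)^{-ε} ψ̂(ξ)`, the Fourier transform of `K_m^ε ψ`. -/
def smoothingIntegrand (m ε : ℝ) (ψ : L2Spinor) (ξ : Space3) : Spinor :=
  (kgSymbol m ξ ^ (-ε)) • (𝓕 ψ : L2Spinor) ξ

/-- `K_m^ε = (-Δ + m²)^{-ε}`, as the pointwise inverse Fourier integral
`(K_m^ε ψ)(x) = ∫ exp(2πi ⟨ξ, x⟩) (|2πξ|² + m²)^{-ε} ψ̂(ξ) dξ`. -/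
def smoothing (m ε : ℝ) (ψ : L2Spinor) (x : Space3) : Spinor :=
  𝓕⁻ (smoothingIntegrand m ε ψ) x

/-- The Bessel function of the first kind `J_n` of integer order `n ≥ 0`. -/
def besselJ (n : ℕ) (x : ℝ) : ℝ :=
  ∑' k : ℕ, (-1) ^ k / ((k ! : ℝ) * ((k + n)! : ℝ)) * (x / 2) ^ (2 * k + n)

/-- The Heaviside function. -/
def heaviside (s : ℝ) : ℝ := if 0 ≤ s then 1 else 0

/-- The derivative of a function on `[0, ∞)`, one-sided at `0`. -/
def timeDeriv (ζ : ℝ → Spinor) (t : ℝ) : Spinor := derivWithin ζ (Ici 0) t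

/-- `ζ̈ ∈ L²_loc[0, ∞)`: the derivative of `ζ` is locally absolutely continuous on `[0, ∞)`,
and its derivative `η` is square integrable on every `[0, T]`. -/
def SecondDerivL2Loc (ζ : ℝ → Spinor) : Prop :=
  ∃ η : ℝ → Spinor, (∀ T : ℝ, 0 < T → MemLp η 2 (volume.restrict (Icc 0 T))) ∧
    ∀ t : ℝ, 0 ≤ t → timeDeriv ζ t = timeDeriv ζ 0 + ∫ s in (0 : ℝ)..t, η s

/-- The solution `p_S(·, t)` of the Klein-Gordon equation with source `ζ̇(t) δ(x)` and zero
initial data. -/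
def pS (m : ℝ) (ζ : ℝ → Spinor) (t : ℝ) (x : Space3) : Spinor :=
  (heaviside (t - ‖x‖) / (4 * π * ‖x‖)) • timeDeriv ζ (t - ‖x‖)
    - (m / (4 * π)) • ∫ s in (0 : ℝ)..t,
        (heaviside (s - ‖x‖) * besselJ 1 (m * √(s ^ 2 - ‖x‖ ^ 2)) / √(s ^ 2 - ‖x‖ ^ 2)) •
          timeDeriv ζ (t - s)

/-- The tail `∫_a^∞ J₁(u)/u du`. -/
def besselTail (a : ℝ) : ℝ := ∫ u in Ioi a, besselJ 1 u / u

end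

/-!
The idea is to reduce everything to the scalar Fourier transform of `p = p_S(·, t)` and to evaluate
the limit in position space. Write `g = ζ̇` and `ω = √(4π²|ξ|² + m²)`.

* The field `p` is radial, and its Fourier transform is `p̂(ξ) = ∫₀ᵗ sin(ω s)/ω g(t - s) ds`
  (`fourier_kgProfile_norm`). This combines the radial Fourier transform on `ℝ³`
  (`fourier_radial_space3`, from cylindrical coordinates), one integration by parts that replaces
  `J₁` by `J₀` (`integral_smul_kgProfile`), and the identity
  `∫₀ˢ cos(κ r) J₀(m √(s² - r²)) dr = sin(ω s)/ω` (`integral_cos_mul_besselEntire`).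
* As `g` has an integrable derivative, `p̂ = O(ω⁻²)` (`exists_norm_integral_sin_smul_le`). The
  transform of `K^ε D⁻¹ p` is `ω^{-2ε} ω⁻² (2π α·ξ + m β) p̂`, which is `O(ω^{-3-2ε})` and so
  integrable. At `x = 0` the part `α·ξ` is odd and drops out; what remains is `O(ω^{-4})` uniformly
  in `ε`, and the iterated limit is `m β ∫ ω⁻² p̂ dξ` (`tendsto_smoothing_diracInv`).
* As `ω⁻²` is the Fourier transform of the Yukawa potential `e^{-m r}/(4π r)`, Plancherel's theorem
  turns this integral into `∫ e^{-m|x|}/(4π|x|) p(x) dx` (`integral_kgSymbol_inv_smul_fourier`).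
  The same radial pairing as before evaluates it to
  `(4π)⁻¹ ∫₀ᵗ (J₀(m s) - m s T(m s)) g(t - s) ds` for `T(a) = ∫_a^∞ J₁(u)/u du`
  (`integral_yukawa_smul_kgProfile`), where the tail `T` enters through
  `∫₀ˢ e^{-m r} J₀(m √(s² - r²)) dr = s T(m s)` (`integral_exp_mul_besselEntire`).
* As `u T(u) - J₀(u)` is a primitive of `T`, integration by parts in time gives the stated formula
  (`integral_besselJ_sub_smul_timeDeriv`).

The convergence of `∫₀^∞ J₁(u)/u du` rests on the decay `J₁(u) = O(u^{-1/2})`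
(`exists_besselJ_one_sq_le`).
-/

noncomputable section

/-! ### Bessel functions of order zero and one -/

/-- The entire function `∑ (-x)^k / (k! (k+n)!)`, for which
`J_n(z) = (z/2)^n * besselEntire n ((z/2)^2)`. -/
def besselEntire (n : ℕ) (x : ℝ) : ℝ :=
  ∑' k : ℕ, (-1) ^ k / ((k ! : ℝ) * ((k + n)! : ℝ)) * x ^ k

theorem norm_besselEntire_coeff_mul_le (n k : ℕ) (a : ℝ) :
    ‖(-1) ^ k / ((k ! : ℝ) * ((k + n)! : ℝ)) * a‖ ≤ |a| / (k ! : ℝ) := by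
  have h1 : (1 : ℝ) ≤ ((k + n)! : ℝ) := by exact_mod_cast Nat.succ_le_of_lt (Nat.factorial_pos _)
  have h0 : (0 : ℝ) < (k ! : ℝ) := by exact_mod_cast Nat.factorial_pos _
  have h2 : (k ! : ℝ) ≤ (k ! : ℝ) * ((k + n)! : ℝ) := le_mul_of_one_le_right h0.le h1
  rw [norm_mul, norm_div, norm_pow, norm_neg, norm_one, one_pow, Real.norm_eq_abs,
    Real.norm_eq_abs, abs_of_pos (h0.trans_le h2), div_mul_eq_mul_div, one_mul]
  gcongr

theorem summable_besselEntire (n : ℕ) (x : ℝ) :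
    Summable fun k : ℕ => (-1) ^ k / ((k ! : ℝ) * ((k + n)! : ℝ)) * x ^ k := by
  refine Summable.of_norm_bounded (Real.summable_pow_div_factorial |x|) fun k => ?_
  exact (norm_besselEntire_coeff_mul_le n k _).trans_eq (by rw [abs_pow])

theorem summable_besselEntire_mul_natCast (n : ℕ) (x : ℝ) :
    Summable fun k : ℕ => (-1) ^ k / ((k ! : ℝ) * ((k + n)! : ℝ)) * (k * x ^ k) := by
  refine Summable.of_norm_bounded (g := fun k : ℕ => (k : ℝ) * |x| ^ k / (k ! : ℝ)) ?_ fun k =>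
    (norm_besselEntire_coeff_mul_le n k _).trans_eq (by simp [abs_mul])
  rw [← summable_nat_add_iff 1]
  refine ((Real.summable_pow_div_factorial |x|).mul_left |x|).congr fun k => ?_
  rw [Nat.factorial_succ, pow_succ]
  have h0 : (k ! : ℝ) ≠ 0 := by exact_mod_cast Nat.factorial_ne_zero _
  have h1 : ((k : ℝ) + 1) ≠ 0 := by positivity
  push_cast
  field_simp

theorem besselEntire_zero (n : ℕ) : besselEntire n 0 = 1 / (n ! : ℝ) := by
  unfold besselEntire
  rw [tsum_eq_single 0]
  · simp
  · intro k hk; simp [hk]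

theorem hasDerivAt_besselEntire (n : ℕ) (x : ℝ) :
    HasDerivAt (besselEntire n) (-besselEntire (n + 1) x) x := by
  set R := |x| + 1 with hR
  have hR0 : 0 ≤ R := by positivity
  have hu : Summable fun k : ℕ => (k : ℝ) * R ^ (k - 1) / (k ! : ℝ) := by
    rw [← summable_nat_add_iff 1]
    refine (Real.summable_pow_div_factorial R).congr fun k => ?_
    rw [Nat.factorial_succ, Nat.add_sub_cancel]
    have h0 : (k ! : ℝ) ≠ 0 := by exact_mod_cast Nat.factorial_ne_zero _
    have h1 : ((k : ℝ) + 1) ≠ 0 := by positivity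
    push_cast
    field_simp
  have hbound : ∀ (k : ℕ) (y : ℝ), |y| ≤ R →
      ‖(-1) ^ k / ((k ! : ℝ) * ((k + n)! : ℝ)) * (k * y ^ (k - 1))‖
        ≤ (k : ℝ) * R ^ (k - 1) / (k ! : ℝ) := by
    intro k y hy
    refine (norm_besselEntire_coeff_mul_le n k _).trans ?_
    rw [abs_mul, Nat.abs_cast, abs_pow]
    gcongr
  have key := hasDerivAt_tsum_of_isPreconnected (y₀ := x) (y := x)
    (g := fun (k : ℕ) (y : ℝ) => (-1) ^ k / ((k ! : ℝ) * ((k + n)! : ℝ)) * y ^ k)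
    (g' := fun (k : ℕ) (y : ℝ) => (-1) ^ k / ((k ! : ℝ) * ((k + n)! : ℝ)) * (k * y ^ (k - 1)))
    hu (Metric.isOpen_ball (x := (0 : ℝ)) (ε := R)) (convex_ball _ _).isPreconnected
    (fun k y _ => (hasDerivAt_pow k y).const_mul _)
    (fun k y hy => hbound k y (by simpa using (Metric.mem_ball.1 hy).le))
    (by simp [hR]) (summable_besselEntire n x) (by simp [hR])
  have e : -besselEntire (n + 1) x
      = ∑' k : ℕ, (-1) ^ k / ((k ! : ℝ) * ((k + n)! : ℝ)) * (k * x ^ (k - 1)) := by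
    rw [(Summable.of_norm_bounded hu fun k => hbound k x (by simp [hR])).tsum_eq_zero_add]
    simp only [besselEntire, CharP.cast_eq_zero, zero_mul, mul_zero, zero_add, ← tsum_neg]
    refine tsum_congr fun k => ?_
    rw [Nat.factorial_succ, Nat.add_sub_cancel, pow_succ, add_right_comm k 1 n, add_assoc k n 1]
    have h0 : (k ! : ℝ) ≠ 0 := by exact_mod_cast Nat.factorial_ne_zero _
    have h2 : ((k + (n + 1))! : ℝ) ≠ 0 := by exact_mod_cast Nat.factorial_ne_zero _
    have h1 : ((k : ℝ) + 1) ≠ 0 := by positivity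
    push_cast
    field_simp
  rw [e]
  exact key

@[fun_prop]
theorem continuous_besselEntire (n : ℕ) : Continuous (besselEntire n) :=
  continuous_iff_continuousAt.2 fun x => (hasDerivAt_besselEntire n x).continuousAt

/-- The three-term recurrence of the Bessel functions. -/
theorem besselEntire_recurrence (n : ℕ) (x : ℝ) :
    besselEntire n x = (n + 1) * besselEntire (n + 1) x - x * besselEntire (n + 2) x := by
  have h2 : x * besselEntire (n + 2) x
      = -∑' k : ℕ, (-1) ^ k / ((k ! : ℝ) * ((k + (n + 1))! : ℝ)) * (k * x ^ k) := by
    rw [(summable_besselEntire_mul_natCast (n + 1) x).tsum_eq_zero_add]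
    simp only [besselEntire, CharP.cast_eq_zero, zero_mul, mul_zero, zero_add, ← tsum_neg,
      ← tsum_mul_left]
    refine tsum_congr fun k => ?_
    rw [Nat.factorial_succ, add_assoc k 1, add_comm 1 (n + 1)]
    have h0 : (k ! : ℝ) ≠ 0 := by exact_mod_cast Nat.factorial_ne_zero _
    have h2 : ((k + (n + 1 + 1))! : ℝ) ≠ 0 := by exact_mod_cast Nat.factorial_ne_zero _
    have h1 : ((k : ℝ) + 1) ≠ 0 := by positivity
    push_cast
    field_simp
    ring
  rw [h2, sub_neg_eq_add]
  unfold besselEntire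
  rw [← tsum_mul_left, ← Summable.tsum_add]
  · refine tsum_congr fun k => ?_
    rw [← add_assoc, Nat.factorial_succ]
    have h0 : (k ! : ℝ) ≠ 0 := by exact_mod_cast Nat.factorial_ne_zero _
    have h2 : ((k + n)! : ℝ) ≠ 0 := by exact_mod_cast Nat.factorial_ne_zero _
    have h1 : ((k : ℝ) + n + 1) ≠ 0 := by positivity
    push_cast
    field_simp
    ring
  · exact (summable_besselEntire (n + 1) x).mul_left _
  · exact summable_besselEntire_mul_natCast (n + 1) x

theorem besselJ_eq (n : ℕ) (x : ℝ) :
    besselJ n x = (x / 2) ^ n * besselEntire n ((x / 2) ^ 2) := by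
  unfold besselJ besselEntire
  rw [← tsum_mul_left]
  refine tsum_congr fun k => ?_
  rw [pow_add, pow_mul]
  ring

theorem besselJ_zero_eq (x : ℝ) : besselJ 0 x = besselEntire 0 ((x / 2) ^ 2) := by
  rw [besselJ_eq, pow_zero, one_mul]

theorem besselJ_one_eq (x : ℝ) : besselJ 1 x = x / 2 * besselEntire 1 ((x / 2) ^ 2) := by
  rw [besselJ_eq, pow_one]

theorem hasDerivAt_besselJ_zero (x : ℝ) : HasDerivAt (besselJ 0) (-besselJ 1 x) x := by
  have h := (hasDerivAt_besselEntire 0 ((x / 2) ^ 2)).comp x (((hasDerivAt_id x).div_const 2).pow 2)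
  rw [show besselJ 0 = besselEntire 0 ∘ fun x => (x / 2) ^ 2 from funext besselJ_zero_eq]
  refine h.congr_deriv ?_
  rw [besselJ_one_eq]
  simp
  ring

theorem hasDerivAt_besselJ_one {x : ℝ} (hx : x ≠ 0) :
    HasDerivAt (besselJ 1) (besselJ 0 x - besselJ 1 x / x) x := by
  have h := ((hasDerivAt_id x).div_const 2).mul
    ((hasDerivAt_besselEntire 1 ((x / 2) ^ 2)).comp x (((hasDerivAt_id x).div_const 2).pow 2))
  rw [show besselJ 1 = fun x => x / 2 * besselEntire 1 ((x / 2) ^ 2) from funext besselJ_one_eq]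
  refine h.congr_deriv ?_
  rw [besselJ_zero_eq, besselEntire_recurrence 0]
  simp
  field_simp
  ring

theorem continuous_besselJ_zero : Continuous (besselJ 0) :=
  continuous_iff_continuousAt.2 fun x => (hasDerivAt_besselJ_zero x).continuousAt

theorem besselJ_zero_zero : besselJ 0 0 = 1 := by simp [besselJ_zero_eq, besselEntire_zero]

theorem besselJ_one_zero : besselJ 1 0 = 0 := by simp [besselJ_one_eq]

theorem continuous_besselJ_one : Continuous (besselJ 1) := by
  rw [show besselJ 1 = fun x => x / 2 * besselEntire 1 ((x / 2) ^ 2) from funext besselJ_one_eq]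
  fun_prop

/-- On `[0, ∞)` the function `J₀² + J₁²` has derivative `-2 J₁²/x`, so it is at most its value
`1` at the origin. -/
theorem besselJ_sq_add_sq_le_one {x : ℝ} (hx : 0 ≤ x) :
    besselJ 0 x ^ 2 + besselJ 1 x ^ 2 ≤ 1 := by
  have ha : AntitoneOn (fun x => besselJ 0 x ^ 2 + besselJ 1 x ^ 2) (Ici 0) := by
    refine antitoneOn_of_hasDerivWithinAt_nonpos (convex_Ici 0)
      (f' := fun x => -(2 * besselJ 1 x ^ 2 / x))
      ((continuous_besselJ_zero.pow 2).add (continuous_besselJ_one.pow 2)).continuousOn ?_ ?_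
    · intro x hx
      rw [interior_Ici] at hx
      have hx0 : x ≠ 0 := ne_of_gt hx
      refine ((((hasDerivAt_besselJ_zero x).pow 2).add
        ((hasDerivAt_besselJ_one hx0).pow 2)).congr_deriv ?_).hasDerivWithinAt
      simp
      field_simp
      ring
    · intro x hx
      rw [interior_Ici] at hx
      have : (0 : ℝ) < x := hx
      rw [neg_nonpos]
      positivity
  have h := ha (self_mem_Ici) hx hx
  simpa [besselJ_zero_zero, besselJ_one_zero] using h

theorem abs_besselJ_zero_le_one (x : ℝ) : |besselJ 0 x| ≤ 1 := by
  have e : besselJ 0 x = besselJ 0 |x| := by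
    rw [besselJ_zero_eq, besselJ_zero_eq, div_pow, div_pow, sq_abs]
  rw [e, abs_le_one_iff_mul_self_le_one]
  nlinarith [besselJ_sq_add_sq_le_one (abs_nonneg x), sq_nonneg (besselJ 1 |x|)]

/-- `J₁` decays like `x^{-1/2}`. The energy `E = x (J₀² + J₁²) - J₀ J₁` has derivative
`J₀ J₁ / x`, which is at most `E / x²` for `x ≥ 1`, so that `E e^{1/x}` is nonincreasing. -/
theorem exists_besselJ_one_sq_le : ∃ C : ℝ, ∀ x : ℝ, 1 ≤ x → besselJ 1 x ^ 2 ≤ C / x := by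
  set E : ℝ → ℝ := fun x => x * (besselJ 0 x ^ 2 + besselJ 1 x ^ 2) - besselJ 0 x * besselJ 1 x
    with hE
  have hE2 : ∀ x, 1 ≤ x → x / 2 * (besselJ 0 x ^ 2 + besselJ 1 x ^ 2) ≤ E x := by
    intro x hx
    simp only [hE]
    nlinarith [sq_nonneg (besselJ 0 x - besselJ 1 x), sq_nonneg (besselJ 0 x),
      sq_nonneg (besselJ 1 x)]
  have hd : ∀ x : ℝ, x ≠ 0 → HasDerivAt (fun x => E x * Real.exp x⁻¹)
      ((besselJ 0 x * besselJ 1 x / x - E x / x ^ 2) * Real.exp x⁻¹) x := by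
    intro x hx
    have h0 := hasDerivAt_besselJ_zero x
    have h1 := hasDerivAt_besselJ_one hx
    have h := ((((hasDerivAt_id x).mul ((h0.pow 2).add (h1.pow 2))).sub (h0.mul h1)).mul
      ((hasDerivAt_inv hx).exp))
    refine h.congr_deriv ?_
    simp [hE]
    field_simp
    ring
  have ha : AntitoneOn (fun x => E x * Real.exp x⁻¹) (Ici 1) := by
    have hpos : ∀ x ∈ Ici (1 : ℝ), x ≠ 0 := fun x hx => (zero_lt_one.trans_le hx).ne'
    refine antitoneOn_of_hasDerivWithinAt_nonpos (convex_Ici 1)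
      (fun x hx => (hd x (hpos x hx)).continuousAt.continuousWithinAt)
      (fun x hx => (hd x (hpos x (interior_subset hx))).hasDerivWithinAt) fun x hx => ?_
    have hx1 : 1 ≤ x := interior_subset hx
    have hx0 : 0 < x := zero_lt_one.trans_le hx1
    refine mul_nonpos_of_nonpos_of_nonneg ?_ (Real.exp_pos _).le
    rw [sub_nonpos, div_le_div_iff₀ hx0 (by positivity)]
    nlinarith [mul_le_mul_of_nonneg_right (hE2 x hx1) hx0.le,
      mul_nonneg (sq_nonneg x) (sq_nonneg (besselJ 0 x - besselJ 1 x))]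
  refine ⟨2 * (E 1 * Real.exp 1⁻¹), fun x hx => ?_⟩
  have hx0 : 0 < x := zero_lt_one.trans_le hx
  have h1 : E x * Real.exp x⁻¹ ≤ E 1 * Real.exp 1⁻¹ := ha self_mem_Ici hx hx
  have h2 := hE2 x hx
  have h3 : 0 ≤ x / 2 * (besselJ 0 x ^ 2 + besselJ 1 x ^ 2) := by positivity
  have h4 : 1 ≤ Real.exp x⁻¹ := Real.one_le_exp (by positivity)
  rw [le_div_iff₀ hx0]
  nlinarith [mul_nonneg hx0.le (sq_nonneg (besselJ 0 x))]

/-! ### Integral identities for Bessel functions -/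

/-- Differentiation under an integral over a compact interval, for jointly continuous data. -/
theorem hasDerivAt_intervalIntegral_of_continuous {F F' : ℝ → ℝ → ℝ} (a b : ℝ)
    (hF : Continuous (Function.uncurry F)) (hF' : Continuous (Function.uncurry F'))
    (hd : ∀ x y, HasDerivAt (fun x => F x y) (F' x y) x) (x₀ : ℝ) :
    HasDerivAt (fun x => ∫ y in a..b, F x y) (∫ y in a..b, F' x₀ y) x₀ := by
  obtain ⟨C, hC⟩ := ((isCompact_Icc (a := x₀ - 1) (b := x₀ + 1)).prod
    (isCompact_uIcc (a := a) (b := b))).exists_bound_of_continuousOn hF'.continuousOn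
  have hFx : ∀ x, Continuous (F x) := fun x => hF.comp (by fun_prop : Continuous fun y => (x, y))
  have hFx' : ∀ x, Continuous (F' x) := fun x => hF'.comp (by fun_prop : Continuous fun y => (x, y))
  refine (intervalIntegral.hasDerivAt_integral_of_dominated_loc_of_deriv_le (bound := fun _ => C)
    (Icc_mem_nhds (by linarith) (by linarith) : Icc (x₀ - 1) (x₀ + 1) ∈ 𝓝 x₀)
    (Eventually.of_forall fun x => (hFx x).aestronglyMeasurable)
    ((hFx x₀).intervalIntegrable _ _) (hFx' x₀).aestronglyMeasurable
    (Eventually.of_forall fun y hy x hx => ?_) intervalIntegrable_const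
    (Eventually.of_forall fun y _ x _ => hd x y)).2
  exact hC (x, y) ⟨hx, uIoc_subset_uIcc hy⟩

/-- The integral `∫₀ˢ cos(κ r) J₀(m √(s² - r²)) dr` depends on `κ, m` only through
`ω = √(κ² + m²)`: for `κ = ω cos θ` and `m = ω sin θ` its integrand has a `θ`-derivative which is an
`r`-derivative of a function vanishing at both ends. At `m = 0` the integral is `sin(ω s)/ω`. -/
theorem integral_cos_mul_besselEntire {κ m : ℝ} {ω : ℝ} (hω : 0 < ω) (h : κ ^ 2 + m ^ 2 = ω ^ 2)
    (s : ℝ) :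
    ∫ r in (0 : ℝ)..s, Real.cos (κ * r) * besselEntire 0 ((m / 2) ^ 2 * (s ^ 2 - r ^ 2))
      = Real.sin (ω * s) / ω := by
  obtain ⟨θ, hκ, hm⟩ : ∃ θ : ℝ, κ = ω * Real.cos θ ∧ m = ω * Real.sin θ := by
    refine ⟨Complex.arg ⟨κ, m⟩, ?_, ?_⟩
    · have hn : ‖(⟨κ, m⟩ : ℂ)‖ = ω := by
        rw [Complex.norm_def, Complex.normSq_mk, ← sq, ← sq, h, Real.sqrt_sq hω.le]
      rw [← hn, Complex.norm_mul_cos_arg]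
    · have hn : ‖(⟨κ, m⟩ : ℂ)‖ = ω := by
        rw [Complex.norm_def, Complex.normSq_mk, ← sq, ← sq, h, Real.sqrt_sq hω.le]
      rw [← hn, Complex.norm_mul_sin_arg]
  subst hκ hm
  set F : ℝ → ℝ → ℝ := fun θ r => Real.cos (ω * Real.cos θ * r) *
    besselEntire 0 ((ω * Real.sin θ / 2) ^ 2 * (s ^ 2 - r ^ 2)) with hF
  -- the `θ`-derivative of `F`, which `hV` shows to be the `r`-derivative of
  -- `-w J₁(m w) sin(κ r)`, where `w = √(s² - r²)`
  set F' : ℝ → ℝ → ℝ := fun θ r =>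
    ω * Real.sin θ * r * Real.sin (ω * Real.cos θ * r) *
      besselEntire 0 ((ω * Real.sin θ / 2) ^ 2 * (s ^ 2 - r ^ 2))
    - Real.cos (ω * Real.cos θ * r) * (besselEntire 1 ((ω * Real.sin θ / 2) ^ 2 * (s ^ 2 - r ^ 2)) *
      (ω ^ 2 / 2 * Real.sin θ * Real.cos θ * (s ^ 2 - r ^ 2))) with hF'
  have hd : ∀ θ r, HasDerivAt (fun θ => F θ r) (F' θ r) θ := by
    intro θ r
    have h1 := (((Real.hasDerivAt_cos θ).const_mul ω).mul_const r).cos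
    have h2 := (hasDerivAt_besselEntire 0 ((ω * Real.sin θ / 2) ^ 2 * (s ^ 2 - r ^ 2))).comp θ
      (((((Real.hasDerivAt_sin θ).const_mul ω).div_const 2).pow 2).mul_const (s ^ 2 - r ^ 2))
    refine (h1.mul h2).congr_deriv ?_
    simp [hF']
    ring
  have hV : ∀ θ r, HasDerivAt (fun r => -(ω * Real.sin θ / 2 * (s ^ 2 - r ^ 2) *
      besselEntire 1 ((ω * Real.sin θ / 2) ^ 2 * (s ^ 2 - r ^ 2)) *
      Real.sin (ω * Real.cos θ * r))) (F' θ r) r := by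
    intro θ r
    have h0 : HasDerivAt (fun r : ℝ => s ^ 2 - r ^ 2) (-(2 * r)) r := by
      simpa using (hasDerivAt_pow 2 r).const_sub (s ^ 2)
    have h1 := ((hasDerivAt_id r).const_mul (ω * Real.cos θ)).sin
    have h2 := (hasDerivAt_besselEntire 1 ((ω * Real.sin θ / 2) ^ 2 * (s ^ 2 - r ^ 2))).comp r
      (h0.const_mul ((ω * Real.sin θ / 2) ^ 2))
    refine ((((h0.const_mul (ω * Real.sin θ / 2)).mul h2).mul h1).neg).congr_deriv ?_
    simp only [hF', besselEntire_recurrence 0]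
    simp
    ring
  have hFc : Continuous (Function.uncurry F) := by
    simp only [hF, Function.uncurry_def]; fun_prop
  have hFc' : Continuous (Function.uncurry F') := by
    simp only [hF', Function.uncurry_def]; fun_prop
  have hder : ∀ θ, HasDerivAt (fun θ => ∫ r in (0 : ℝ)..s, F θ r) 0 θ := by
    intro θ
    refine (hasDerivAt_intervalIntegral_of_continuous 0 s hFc hFc' hd θ).congr_deriv ?_
    rw [intervalIntegral.integral_eq_sub_of_hasDerivAt (fun r _ => hV θ r)
      ((hFc'.comp (by fun_prop : Continuous fun y => (θ, y))).intervalIntegrable _ _)]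
    simp
  have hconst := is_const_of_deriv_eq_zero (fun θ => (hder θ).differentiableAt)
    (fun θ => (hder θ).deriv) θ 0
  refine hconst.trans ?_
  simp only [hF, Real.cos_zero, Real.sin_zero, mul_one, mul_zero, zero_div, ne_eq,
    OfNat.ofNat_ne_zero, not_false_eq_true, zero_pow, zero_mul, besselEntire_zero,
    Nat.factorial_zero, Nat.cast_one, div_one]
  rw [intervalIntegral.integral_comp_mul_left _ hω.ne']
  simp [div_eq_inv_mul]

/-- The mean `∫₀¹ e^{-s y} J₀(s √(1 - y²)) dy`, equal to `∫_s^∞ J₁(u)/u du` for `s ≥ 0` and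
smooth on the whole line. -/
def besselMean (s : ℝ) : ℝ :=
  ∫ y in (0 : ℝ)..1, Real.exp (-(s * y)) * besselEntire 0 ((s / 2) ^ 2 * (1 - y ^ 2))

/-- The derivative of `besselMean` is `-J₁(s)/s`: the `s`-derivative of the integrand is the
`y`-derivative of `√(1 - y²) e^{-s y} J₁(s √(1 - y²)) / s`. -/
theorem hasDerivAt_besselMean (s : ℝ) :
    HasDerivAt besselMean (-(besselEntire 1 ((s / 2) ^ 2) / 2)) s := by
  set F : ℝ → ℝ → ℝ := fun s y => Real.exp (-(s * y)) * besselEntire 0 ((s / 2) ^ 2 * (1 - y ^ 2))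
    with hF
  set F' : ℝ → ℝ → ℝ := fun s y => Real.exp (-(s * y)) *
    (-(y * besselEntire 0 ((s / 2) ^ 2 * (1 - y ^ 2)))
      - s / 2 * (1 - y ^ 2) * besselEntire 1 ((s / 2) ^ 2 * (1 - y ^ 2))) with hF'
  have hd : ∀ s y, HasDerivAt (fun s => F s y) (F' s y) s := by
    intro s y
    have h1 := ((hasDerivAt_id s).mul_const y).neg.exp
    have h2 := (hasDerivAt_besselEntire 0 ((s / 2) ^ 2 * (1 - y ^ 2))).comp s
      ((((hasDerivAt_id s).div_const 2).pow 2).mul_const (1 - y ^ 2))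
    refine (h1.mul h2).congr_deriv ?_
    simp [hF']
    ring
  have hV : ∀ y, HasDerivAt (fun y => (1 - y ^ 2) / 2 *
      besselEntire 1 ((s / 2) ^ 2 * (1 - y ^ 2)) * Real.exp (-(s * y))) (F' s y) y := by
    intro y
    have h0 : HasDerivAt (fun y : ℝ => 1 - y ^ 2) (-(2 * y)) y := by
      simpa using (hasDerivAt_pow 2 y).const_sub 1
    have h1 := ((hasDerivAt_id y).const_mul s).neg.exp
    have h2 := (hasDerivAt_besselEntire 1 ((s / 2) ^ 2 * (1 - y ^ 2))).comp y
      (h0.const_mul ((s / 2) ^ 2))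
    refine (((h0.div_const 2).mul h2).mul h1).congr_deriv ?_
    simp only [hF', besselEntire_recurrence 0]
    simp
    ring
  have hFc : Continuous (Function.uncurry F) := by
    simp only [hF, Function.uncurry_def]; fun_prop
  have hFc' : Continuous (Function.uncurry F') := by
    simp only [hF', Function.uncurry_def]; fun_prop
  refine (hasDerivAt_intervalIntegral_of_continuous 0 1 hFc hFc' hd s).congr_deriv ?_
  rw [intervalIntegral.integral_eq_sub_of_hasDerivAt (fun y _ => hV y)
    ((hFc'.comp (by fun_prop : Continuous fun y => (s, y))).intervalIntegrable _ _)]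
  simp
  ring

theorem besselJ_one_div {x : ℝ} (hx : x ≠ 0) :
    besselJ 1 x / x = besselEntire 1 ((x / 2) ^ 2) / 2 := by
  rw [besselJ_one_eq]; field_simp

/-- As `|J₀| ≤ 1`, the mean is at most `∫₀¹ e^{-s y} dy ≤ 1/s`. -/
theorem tendsto_besselMean_atTop : Tendsto besselMean atTop (𝓝 0) := by
  have hb : ∀ s : ℝ, 0 < s → ‖besselMean s‖ ≤ s⁻¹ := by
    intro s hs
    have h1 : ‖besselMean s‖ ≤ ∫ y in (0 : ℝ)..1, Real.exp (-(s * y)) := by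
      refine intervalIntegral.norm_integral_le_of_norm_le zero_le_one
        (Eventually.of_forall fun y hy => ?_)
        (Continuous.intervalIntegrable (by fun_prop) _ _)
      have hy2 : 0 ≤ 1 - y ^ 2 := by nlinarith [hy.1, hy.2]
      have e : (s / 2) ^ 2 * (1 - y ^ 2) = (s * √(1 - y ^ 2) / 2) ^ 2 := by
        rw [div_pow, div_pow, mul_pow, Real.sq_sqrt hy2]; ring
      rw [norm_mul, Real.norm_of_nonneg (Real.exp_pos _).le, e, ← besselJ_zero_eq,
        Real.norm_eq_abs]
      exact mul_le_of_le_one_right (Real.exp_pos _).le (abs_besselJ_zero_le_one _)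
    refine h1.trans ?_
    have h2 : ∀ y ∈ uIcc (0 : ℝ) 1, HasDerivAt (fun y => -(s⁻¹ * Real.exp (-(s * y))))
        (Real.exp (-(s * y))) y := by
      intro y _
      refine ((((hasDerivAt_id y).const_mul s).neg.exp.const_mul s⁻¹).neg).congr_deriv ?_
      simp
      field_simp
    rw [intervalIntegral.integral_eq_sub_of_hasDerivAt h2
      (Continuous.intervalIntegrable (by fun_prop) _ _)]
    have : 0 < s⁻¹ * Real.exp (-(s * 1)) := by positivity
    simp at this ⊢
    exact this.le
  exact squeeze_zero_norm' ((eventually_gt_atTop 0).mono hb) tendsto_inv_atTop_zero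

theorem integrableOn_besselJ_one_div : IntegrableOn (fun u : ℝ => besselJ 1 u / u) (Ioi 0) := by
  rw [← Ioc_union_Ioi_eq_Ioi zero_le_one]
  refine IntegrableOn.union ?_ ?_
  · have h : IntegrableOn (fun u : ℝ => besselEntire 1 ((u / 2) ^ 2) / 2) (Ioc 0 1) :=
      (Continuous.integrableOn_Icc (by fun_prop)).mono_set Ioc_subset_Icc_self
    exact h.congr_fun (fun u hu => (besselJ_one_div (ne_of_gt hu.1)).symm) measurableSet_Ioc
  · obtain ⟨C, hC⟩ := exists_besselJ_one_sq_le
    have hr : IntegrableOn (fun u : ℝ => √C * u ^ (-(3 / 2) : ℝ)) (Ioi 1) :=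
      (integrableOn_Ioi_rpow_of_lt (by norm_num) one_pos).const_mul _
    refine Integrable.mono' hr
      (continuous_besselJ_one.measurable.div measurable_id).aestronglyMeasurable ?_
    refine (ae_restrict_iff' measurableSet_Ioi).2 (Eventually.of_forall fun u hu => ?_)
    have hu0 : 0 < u := zero_lt_one.trans hu
    have h1 : |besselJ 1 u| ≤ √(C / u) := Real.abs_le_sqrt (hC u (le_of_lt hu))
    rw [Real.sqrt_div' _ hu0.le] at h1
    have h3 : (0 : ℝ) < √u := Real.sqrt_pos.2 hu0
    have h2 : u ^ (-(3 / 2) : ℝ) = (√u * u)⁻¹ := by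
      rw [Real.rpow_neg hu0.le, show (3 / 2 : ℝ) = 1 / 2 + 1 by norm_num, Real.rpow_add hu0,
        Real.rpow_one, ← Real.sqrt_eq_rpow]
    rw [norm_div, Real.norm_eq_abs, Real.norm_of_nonneg hu0.le, h2]
    calc |besselJ 1 u| / u ≤ √C / √u / u := by gcongr
      _ = √C * (√u * u)⁻¹ := by field_simp

/-- The tail and the mean have the same derivative and both vanish at infinity. -/
theorem besselTail_eq_besselMean {a : ℝ} (ha : 0 ≤ a) : besselTail a = besselMean a := by
  have hI : IntegrableOn (fun u : ℝ => besselJ 1 u / u) (Ioi a) :=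
    integrableOn_besselJ_one_div.mono_set (Ioi_subset_Ioi ha)
  have h1 := intervalIntegral_tendsto_integral_Ioi a hI tendsto_id
  have h2 : Tendsto (fun b => besselMean a - besselMean b) atTop (𝓝 (besselMean a)) := by
    simpa using tendsto_besselMean_atTop.const_sub (besselMean a)
  refine tendsto_nhds_unique h1 (h2.congr' ?_)
  filter_upwards [eventually_ge_atTop a] with b hb
  have h3 : ∫ u in a..b, besselJ 1 u / u = ∫ u in a..b, besselEntire 1 ((u / 2) ^ 2) / 2 := by
    refine intervalIntegral.integral_congr_ae (Eventually.of_forall fun u hu => ?_)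
    rw [uIoc_of_le hb] at hu
    exact besselJ_one_div (ne_of_gt (ha.trans_lt hu.1))
  have h4 := intervalIntegral.integral_eq_sub_of_hasDerivAt (a := a) (b := b)
    (f := fun u => -besselMean u) (f' := fun u => besselEntire 1 ((u / 2) ^ 2) / 2)
    (fun u _ => (hasDerivAt_besselMean u).fun_neg.congr_deriv (neg_neg _))
    (Continuous.intervalIntegrable (by fun_prop) _ _)
  rw [id, h3, h4]
  ring

/-- The substitution `r = s y / m` in `besselMean`. -/
theorem integral_exp_mul_besselEntire {m : ℝ} (hm : 0 < m) {s : ℝ} (hs : 0 ≤ s) :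
    ∫ r in (0 : ℝ)..s, Real.exp (-(m * r)) * besselEntire 0 ((m / 2) ^ 2 * (s ^ 2 - r ^ 2))
      = s * besselTail (m * s) := by
  rw [besselTail_eq_besselMean (by positivity), besselMean, ← smul_eq_mul s]
  have h := intervalIntegral.smul_integral_comp_mul_left (a := 0) (b := 1)
    (fun r => Real.exp (-(m * r)) * besselEntire 0 ((m / 2) ^ 2 * (s ^ 2 - r ^ 2))) s
  rw [mul_zero, mul_one] at h
  rw [← h]
  congr 1
  refine intervalIntegral.integral_congr fun y _ => ?_
  congr 2 <;> ring

/-! ### The Fourier transform of radial functions on `ℝ³` -/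

/-- The Fourier transform on `L²` is given by the Fourier integral for functions that are moreover
integrable: both transforms satisfy the same duality with Schwartz functions. -/
theorem coeFn_fourier_toLp {V F : Type*} [NormedAddCommGroup V] [InnerProductSpace ℝ V]
    [FiniteDimensional ℝ V] [MeasurableSpace V] [BorelSpace V] [NormedAddCommGroup F]
    [InnerProductSpace ℂ F] [CompleteSpace F] {f : V → F} (hf1 : Integrable f)
    (hf2 : MemLp f 2 (volume : Measure V)) :
    ((𝓕 (hf2.toLp f) : Lp F 2 (volume : Measure V)) : V → F) =ᵐ[volume] 𝓕 f := by
  have hcont : Continuous (𝓕 f) := VectorFourier.fourierIntegral_continuous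
    Real.continuous_fourierChar (innerSL ℝ).continuous₂ hf1
  refine ae_eq_of_integral_contDiff_smul_eq
    ((Lp.memLp _).locallyIntegrable (by norm_num)) hcont.locallyIntegrable fun g hg hgc => ?_
  have hg₁ : HasCompactSupport (Complex.ofRealCLM ∘ g) := hgc.comp_left rfl
  have hg₂ : ContDiff ℝ ((⊤ : ℕ∞) : WithTop ℕ∞) (Complex.ofRealCLM ∘ g) := by fun_prop
  set G := hg₁.toSchwartzMap hg₂ with hG
  have hGg : ∀ x, G x = (g x : ℂ) := fun x => rfl
  have h1 : ∫ x, g x • (𝓕 (hf2.toLp f) : Lp F 2 (volume : Measure V)) x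
      = ∫ x, (𝓕 G) x • f x := by
    have h := congrArg (fun T => T G) (Lp.fourier_toTemperedDistribution_eq (hf2.toLp f))
    simp only [TemperedDistribution.fourier_apply, Lp.toTemperedDistribution_apply] at h
    rw [show ∫ x, g x • (𝓕 (hf2.toLp f) : Lp F 2 (volume : Measure V)) x
      = ∫ x, G x • (𝓕 (hf2.toLp f) : Lp F 2 (volume : Measure V)) x by
        simp only [hGg, Complex.coe_smul], ← h]
    refine integral_congr_ae ?_
    filter_upwards [hf2.coeFn_toLp] with x hx
    rw [hx]
  have h2 := VectorFourier.integral_fourierIntegral_smul_eq_flip (L := innerₗ V)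
    (μ := volume) (ν := volume) Real.continuous_fourierChar continuous_inner (G.integrable) hf1
  have h3 : (∫ x, (𝓕 G) x • f x) = ∫ x, G x • 𝓕 f x := by
    rw [flip_innerₗ] at h2
    exact h2
  rw [h1, h3]
  simp only [hGg, Complex.coe_smul]

/-- Splitting off the first coordinate of `ℝ³`. -/
def space3Split : ℝ × EuclideanSpace ℝ (Fin 2) ≃ᵐ Space3 :=
  ((MeasurableEquiv.refl ℝ).prodCongr (MeasurableEquiv.toLp 2 (Fin 2 → ℝ)).symm).trans
    ((MeasurableEquiv.piFinSuccAbove (fun _ : Fin 3 => ℝ) 0).symm.trans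
      (MeasurableEquiv.toLp 2 (Fin 3 → ℝ)))

theorem measurePreserving_space3Split : MeasurePreserving space3Split := by
  refine MeasurePreserving.trans (μb := volume) ?_ (MeasurePreserving.trans (μb := volume)
    (volume_preserving_piFinSuccAbove (fun _ : Fin 3 => ℝ) 0).symm
    (EuclideanSpace.volume_preserving_symm_measurableEquiv_toLp (Fin 3)).symm)
  exact (MeasurePreserving.id _).prod
    (EuclideanSpace.volume_preserving_symm_measurableEquiv_toLp (Fin 2))

theorem space3Split_apply_zero (p : ℝ × EuclideanSpace ℝ (Fin 2)) : space3Split p 0 = p.1 := rfl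

theorem norm_space3Split (p : ℝ × EuclideanSpace ℝ (Fin 2)) :
    ‖space3Split p‖ = √(p.1 ^ 2 + ‖p.2‖ ^ 2) := by
  have h1 : space3Split p 1 = p.2 0 := rfl
  have h2 : space3Split p 2 = p.2 1 := rfl
  rw [EuclideanSpace.norm_eq, EuclideanSpace.norm_sq_eq, Fin.sum_univ_three, Fin.sum_univ_two,
    space3Split_apply_zero, h1, h2]
  simp [add_assoc]

theorem integral_radial_space3 {E : Type*} [NormedAddCommGroup E] [NormedSpace ℝ E] (P : ℝ → E) :
    ∫ x : Space3, P ‖x‖ = ∫ r in Ioi (0 : ℝ), (4 * π * r ^ 2) • P r := by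
  rw [integral_fun_norm_addHaar, measureReal_def, EuclideanSpace.volume_ball_fin_three]
  have hp : (0 : ℝ) ≤ π * 4 / 3 := by positivity
  simp only [finrank_euclideanSpace, Fintype.card_fin, ENNReal.ofReal_one, one_pow, one_mul,
    ENNReal.toReal_ofReal hp, Nat.add_one_sub_one]
  rw [← Nat.cast_smul_eq_nsmul ℝ, smul_smul, ← integral_smul]
  refine integral_congr_ae (Eventually.of_forall fun r => ?_)
  simp only [smul_smul]
  congr 1
  push_cast
  ring

theorem integral_radial_plane {E : Type*} [NormedAddCommGroup E] [NormedSpace ℝ E] (P : ℝ → E) :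
    ∫ y : EuclideanSpace ℝ (Fin 2), P ‖y‖ = ∫ r in Ioi (0 : ℝ), (2 * π * r) • P r := by
  rw [integral_fun_norm_addHaar, measureReal_def, EuclideanSpace.volume_ball_fin_two]
  have hp : (0 : ℝ) ≤ π := by positivity
  simp only [finrank_euclideanSpace, Fintype.card_fin, ENNReal.ofReal_one, one_pow, one_mul,
    Nat.add_one_sub_one]
  rw [← Nat.cast_smul_eq_nsmul ℝ, smul_smul, ← integral_smul]
  refine integral_congr_ae (Eventually.of_forall fun r => ?_)
  simp only [smul_smul]
  congr 1
  rw [ENNReal.toReal_ofReal Real.pi_nonneg]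
  push_cast
  ring

theorem integrable_radial_space3 {E : Type*} [NormedAddCommGroup E] [NormedSpace ℝ E]
    {P : ℝ → E} : Integrable (fun x : Space3 => P ‖x‖) ↔
      IntegrableOn (fun r => r ^ 2 • P r) (Ioi (0 : ℝ)) := by
  rw [integrable_fun_norm_addHaar]
  simp

/-- The substitution `r = √(z² + ρ²)`, without any regularity of `P`. -/
theorem integral_Ioi_comp_sqrt {E : Type*} [NormedAddCommGroup E] [NormedSpace ℝ E] (P : ℝ → E)
    (z : ℝ) :
    ∫ ρ in Ioi (0 : ℝ), ρ • P √(z ^ 2 + ρ ^ 2) = ∫ r in Ioi |z|, r • P r := by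
  have himg : (fun ρ : ℝ => √(z ^ 2 + ρ ^ 2)) '' Ioi 0 = Ioi |z| := by
    ext r
    constructor
    · rintro ⟨ρ, hρ, rfl⟩
      have hρ : 0 < ρ := hρ
      rw [mem_Ioi, ← Real.sqrt_sq_eq_abs]
      exact Real.sqrt_lt_sqrt (sq_nonneg z) (by nlinarith)
    · intro hr
      have hr : |z| < r := hr
      have hr0 : 0 < r := (abs_nonneg z).trans_lt hr
      have h2 : z ^ 2 < r ^ 2 :=
        sq_lt_sq' (by linarith [neg_abs_le z]) ((le_abs_self z).trans_lt hr)
      refine ⟨√(r ^ 2 - z ^ 2), Real.sqrt_pos.2 (by linarith), ?_⟩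
      simp only
      rw [Real.sq_sqrt (by linarith), add_sub_cancel, Real.sqrt_sq hr0.le]
  have hder : ∀ ρ ∈ Ioi (0 : ℝ), HasDerivWithinAt (fun ρ : ℝ => √(z ^ 2 + ρ ^ 2))
      (ρ / √(z ^ 2 + ρ ^ 2)) (Ioi 0) ρ := by
    intro ρ hρ
    have hρ : 0 < ρ := hρ
    have h := ((hasDerivAt_pow 2 ρ).const_add (z ^ 2)).sqrt (by positivity)
    refine (h.congr_deriv ?_).hasDerivWithinAt
    simp
    field_simp
  have hinj : InjOn (fun ρ : ℝ => √(z ^ 2 + ρ ^ 2)) (Ioi 0) := by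
    intro a ha b hb hab
    have ha : 0 < a := ha
    have hb : 0 < b := hb
    have h := (Real.sqrt_inj (by positivity) (by positivity)).1 hab
    exact (sq_eq_sq₀ ha.le hb.le).1 (by linarith)
  rw [← himg, integral_image_eq_integral_abs_deriv_smul measurableSet_Ioi hder hinj]
  refine setIntegral_congr_fun measurableSet_Ioi fun ρ hρ => ?_
  have hρ : 0 < ρ := hρ
  have hs : 0 < √(z ^ 2 + ρ ^ 2) := Real.sqrt_pos.2 (by positivity)
  rw [abs_of_pos (by positivity), smul_smul, div_mul_cancel₀ _ hs.ne']

/-- Integration of a function of one coordinate against a radial function, by cylindrical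
coordinates around the axis of that coordinate. Equivalently, the coordinate is uniformly
distributed on a sphere. -/
theorem integral_coord_smul_radial {E : Type*} [NormedAddCommGroup E] [NormedSpace ℂ E]
    [CompleteSpace E] {c : ℝ → ℂ} (hc : Continuous c) (hb : ∀ z, ‖c z‖ ≤ 1) {P : ℝ → E}
    (hP : Integrable fun x : Space3 => P ‖x‖) :
    ∫ x : Space3, c (x 0) • P ‖x‖
      = ∫ r in Ioi (0 : ℝ), (2 * π * r) • ((∫ z in -r..r, c z) • P r) := by
  have hP2 := integrable_radial_space3.1 hP
  have hPm : AEStronglyMeasurable P (volume.restrict (Ioi 0)) := by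
    have h : AEStronglyMeasurable (fun r : ℝ => (r ^ 2)⁻¹ • (r ^ 2 • P r))
        (volume.restrict (Ioi 0)) :=
      (by fun_prop : Measurable fun r : ℝ => (r ^ 2)⁻¹).aestronglyMeasurable.smul
        hP2.aestronglyMeasurable
    refine h.congr ((ae_restrict_iff' measurableSet_Ioi).2 (Eventually.of_forall fun r hr => ?_))
    have : r ≠ 0 := ne_of_gt hr
    simp [smul_smul, this]
  have hPi : Integrable fun x : Space3 => c (x 0) • P ‖x‖ := by
    refine hP.norm.mono' ((hc.comp (by fun_prop)).aestronglyMeasurable.smul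
      hP.aestronglyMeasurable) (Eventually.of_forall fun x => ?_)
    rw [norm_smul]
    exact mul_le_of_le_one_left (norm_nonneg _) (hb _)
  set S : Set (ℝ × ℝ) := {p | |p.1| < p.2} with hS
  have hSm : MeasurableSet S := measurableSet_lt (by fun_prop) (by fun_prop)
  -- after the substitution `r = √(z² + ρ²)` on each plane, the domain is `|z| < r`
  set h : ℝ → ℝ → E := fun z r => S.indicator (fun p => c p.1 • ((2 * π * p.2) • P p.2)) (z, r)
    with hh
  have hL : ∀ z : ℝ, c z • ∫ y : EuclideanSpace ℝ (Fin 2), P √(z ^ 2 + ‖y‖ ^ 2)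
      = ∫ r in Ioi (0 : ℝ), h z r := by
    intro z
    rw [integral_radial_plane (fun ρ => P √(z ^ 2 + ρ ^ 2))]
    simp only [mul_smul, integral_smul]
    rw [integral_Ioi_comp_sqrt, ← integral_smul, ← integral_smul, ← integral_smul,
      ← inter_eq_right.2 (Ioi_subset_Ioi (abs_nonneg z)), ← setIntegral_indicator measurableSet_Ioi]
    refine integral_congr_ae (Eventually.of_forall fun r => ?_)
    by_cases hr : |z| < r <;> simp [hh, hS, hr, mul_smul, indicator]
  have hR : ∀ r ∈ Ioi (0 : ℝ), ∫ z, h z r = (2 * π * r) • ((∫ z in -r..r, c z) • P r) := by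
    intro r hr
    have hr : 0 < r := hr
    have e : ∀ z, h z r = (Ioo (-r) r).indicator (fun z => c z • ((2 * π * r) • P r)) z := by
      intro z
      by_cases hz : |z| < r
      · have := abs_lt.1 hz
        simp [hh, hS, hz, indicator, this.1, this.2]
      · have : ¬ (-r < z ∧ z < r) := fun h => hz (abs_lt.2 h)
        simp [hh, hS, hz, indicator, mem_Ioo, this]
    simp only [e]
    rw [integral_indicator measurableSet_Ioo, ← integral_Ioc_eq_integral_Ioo,
      ← intervalIntegral.integral_of_le (by linarith), intervalIntegral.integral_smul_const,
      smul_comm]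
  have hint : Integrable (Function.uncurry h) (volume.prod (volume.restrict (Ioi 0))) := by
    have hm : AEStronglyMeasurable (Function.uncurry h)
        (volume.prod (volume.restrict (Ioi (0 : ℝ)))) := by
      refine AEStronglyMeasurable.indicator ?_ hSm
      refine (hc.comp continuous_fst).aestronglyMeasurable.smul ?_
      exact ((by fun_prop : Continuous fun r : ℝ => 2 * π * r).aestronglyMeasurable.smul
        hPm).comp_snd
    have e : ∀ r ∈ Ioi (0 : ℝ), ∀ z, ‖h z r‖ ≤ (Ioo (-r) r).indicator
        (fun _ => 2 * π * r * ‖P r‖) z := by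
      intro r hr z
      have hr : 0 < r := hr
      by_cases hz : |z| < r
      · have := abs_lt.1 hz
        simp only [hh, hS, hz, indicator, mem_ofPred_eq, if_true, mem_Ioo, this.1, this.2, and_self]
        rw [norm_smul, norm_smul, Real.norm_of_nonneg (by positivity)]
        exact mul_le_of_le_one_left (by positivity) (hb _)
      · have : ¬ (-r < z ∧ z < r) := fun h => hz (abs_lt.2 h)
        simp [hh, hS, hz, indicator, mem_Ioo, this]
    have hind : ∀ r : ℝ, Integrable ((Ioo (-r) r).indicator (fun _ : ℝ => 2 * π * r * ‖P r‖)) :=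
      fun r => (integrable_indicator_iff measurableSet_Ioo).2
        (continuous_const.integrableOn_Icc.mono_set Ioo_subset_Icc_self)
    rw [integrable_prod_iff' hm]
    constructor
    · filter_upwards [hm.prodMk_right, ae_restrict_mem measurableSet_Ioi] with r hr1 hr2
      exact (hind r).mono' hr1 (Eventually.of_forall (e r hr2))
    · refine Integrable.mono' (g := fun r => 4 * π * ‖r ^ 2 • P r‖) (hP2.norm.const_mul _)
        hm.norm.prod_swap.integral_prod_right' ?_
      filter_upwards [ae_restrict_mem measurableSet_Ioi, hm.prodMk_right] with r hr hr1
      have hr0 : 0 < r := hr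
      rw [Real.norm_of_nonneg (integral_nonneg fun _ => norm_nonneg _)]
      refine (integral_mono_of_nonneg (Eventually.of_forall fun _ => norm_nonneg _) (hind r)
        (Eventually.of_forall (e r hr))).trans ?_
      rw [integral_indicator measurableSet_Ioo, setIntegral_const, measureReal_def,
        Real.volume_Ioo, ENNReal.toReal_ofReal (by linarith), norm_smul,
        Real.norm_of_nonneg (by positivity), smul_eq_mul]
      apply le_of_eq
      ring
  have hPs : Integrable (fun p : ℝ × EuclideanSpace ℝ (Fin 2) =>
      c p.1 • P √(p.1 ^ 2 + ‖p.2‖ ^ 2)) (volume.prod volume) := by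
    have := (measurePreserving_space3Split.integrable_comp_emb
      space3Split.measurableEmbedding).2 hPi
    simpa only [Function.comp_def, norm_space3Split, space3Split_apply_zero] using! this
  calc ∫ x : Space3, c (x 0) • P ‖x‖
      = ∫ p : ℝ × EuclideanSpace ℝ (Fin 2), c p.1 • P √(p.1 ^ 2 + ‖p.2‖ ^ 2)
          ∂(volume.prod volume) := by
        rw [← measurePreserving_space3Split.integral_comp space3Split.measurableEmbedding
          (fun x => c (x 0) • P ‖x‖)]
        simp only [norm_space3Split, space3Split_apply_zero]
        rfl
    _ = ∫ z, ∫ r in Ioi (0 : ℝ), h z r := by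
        rw [integral_prod _ hPs]
        refine integral_congr_ae (Eventually.of_forall fun z => ?_)
        simp only [← hL, integral_smul]
    _ = ∫ r in Ioi (0 : ℝ), ∫ z, h z r := integral_integral_swap hint
    _ = _ := setIntegral_congr_fun measurableSet_Ioi hR

theorem integral_cexp_symm_interval {κ : ℝ} (hκ : κ ≠ 0) (r : ℝ) :
    ∫ z in -r..r, Complex.exp (((-(κ * z) : ℝ) : ℂ) * Complex.I)
      = ((2 * Real.sin (κ * r) / κ : ℝ) : ℂ) := by
  have hk : (κ : ℂ) ≠ 0 := by exact_mod_cast hκ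
  have h0 : -(κ * Complex.I : ℂ) ≠ 0 := by simp [hk]
  have e : ∀ z : ℝ, ((-(κ * z) : ℝ) : ℂ) * Complex.I = -(κ * Complex.I) * z := by
    intro z; push_cast; ring
  simp only [e]
  rw [integral_exp_mul_complex h0]
  push_cast
  rw [Complex.sin]
  field_simp
  have hI : Complex.I ^ 2 = -1 := Complex.I_sq
  ring_nf
  simp [hI]

/-- The Fourier transform of an integrable radial function on `ℝ³`. -/
theorem fourier_radial_space3 {E : Type*} [NormedAddCommGroup E] [NormedSpace ℂ E]
    [CompleteSpace E] {P : ℝ → E} (hP : Integrable fun x : Space3 => P ‖x‖) {ξ : Space3}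
    (hξ : ξ ≠ 0) :
    𝓕 (fun x : Space3 => P ‖x‖) ξ = ∫ r in Ioi (0 : ℝ),
      (4 * π * r * (Real.sin (2 * π * ‖ξ‖ * r) / (2 * π * ‖ξ‖))) • P r := by
  have hn : ‖ξ‖ ≠ 0 := norm_ne_zero_iff.2 hξ
  set κ : ℝ := 2 * π * ‖ξ‖ with hκ
  have hκ0 : κ ≠ 0 := by positivity
  -- rotate coordinates so that the first axis points along `ξ`
  obtain ⟨b, hbase⟩ := Orthonormal.exists_orthonormalBasis_extension_of_card_eq (𝕜 := ℝ)
    (E := Space3) (ι := Fin 3) (by simp) (v := fun _ => (‖ξ‖⁻¹ : ℝ) • ξ) (s := {0}) (by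
      constructor
      · intro i
        simp [norm_smul, hn]
      · intro i j hij
        exact absurd (Subsingleton.elim i j) hij)
  have hb0 : b 0 = (‖ξ‖⁻¹ : ℝ) • ξ := hbase 0 rfl
  have hinner : ∀ x : Space3, inner ℝ x ξ = ‖ξ‖ * b.repr x 0 := by
    intro x
    rw [b.repr_apply_apply, hb0, real_inner_smul_left, real_inner_comm, ← mul_assoc,
      mul_inv_cancel₀ hn, one_mul]
  rw [Real.fourier_eq']
  have h1 : ∫ x : Space3, Complex.exp (((-2 * π * inner ℝ x ξ : ℝ) : ℂ) * Complex.I) • P ‖x‖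
      = ∫ y : Space3, Complex.exp (((-(κ * y 0) : ℝ) : ℂ) * Complex.I) • P ‖y‖ := by
    rw [← b.measurePreserving_repr.integral_comp b.repr.toHomeomorph.measurableEmbedding
      (fun y : Space3 => Complex.exp (((-(κ * y 0) : ℝ) : ℂ) * Complex.I) • P ‖y‖)]
    refine integral_congr_ae (Eventually.of_forall fun x => ?_)
    simp only [b.repr.norm_map, hinner, hκ]
    congr 4
    ring
  rw [h1, integral_coord_smul_radial (c := fun z => Complex.exp (((-(κ * z) : ℝ) : ℂ) * Complex.I))
    (by fun_prop) (fun z => (Complex.norm_exp_ofReal_mul_I _).le) hP]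
  refine setIntegral_congr_fun measurableSet_Ioi fun r _ => ?_
  simp only [integral_cexp_symm_interval hκ0, Complex.coe_smul, smul_smul]
  congr 1
  ring

/-! ### The retarded Klein-Gordon field -/

@[fun_prop]
theorem measurable_heaviside : Measurable heaviside :=
  Measurable.ite measurableSet_Ici measurable_const measurable_const

theorem heaviside_of_nonneg {s : ℝ} (hs : 0 ≤ s) : heaviside s = 1 := if_pos hs

theorem heaviside_of_neg {s : ℝ} (hs : s < 0) : heaviside s = 0 := if_neg hs.not_ge

theorem abs_heaviside_le_one (s : ℝ) : |heaviside s| ≤ 1 := by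
  unfold heaviside; split_ifs <;> simp

section

variable {E : Type*} [NormedAddCommGroup E] [NormedSpace ℝ E]

/-- Fubini's theorem on the triangle `0 < r ≤ s ≤ t`. -/
theorem integral_heaviside_smul_swap [CompleteSpace E] {k : ℝ → ℝ → ℝ}
    (hk : Continuous (Function.uncurry k)) {t : ℝ} (ht : 0 ≤ t) {h : ℝ → E}
    (hh : IntervalIntegrable h volume 0 t) :
    IntervalIntegrable (fun r => ∫ s in (0 : ℝ)..t, (heaviside (s - r) * k r s) • h s) volume 0 t ∧
    ∫ r in (0 : ℝ)..t, ∫ s in (0 : ℝ)..t, (heaviside (s - r) * k r s) • h s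
      = ∫ s in (0 : ℝ)..t, (∫ r in (0 : ℝ)..s, k r s) • h s := by
  obtain ⟨C, hC⟩ := ((isCompact_Icc (a := 0) (b := t)).prod
    (isCompact_Icc (a := 0) (b := t))).exists_bound_of_continuousOn hk.continuousOn
  have hh' : Integrable h (volume.restrict (Ioc 0 t)) :=
    (intervalIntegrable_iff_integrableOn_Ioc_of_le ht).1 hh
  have hint : Integrable (Function.uncurry fun r s => (heaviside (s - r) * k r s) • h s)
      ((volume.restrict (Ioc 0 t)).prod (volume.restrict (Ioc 0 t))) := by
    refine ((hh'.comp_snd (volume.restrict (Ioc 0 t))).norm.const_mul C).mono' ?_ ?_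
    · refine AEStronglyMeasurable.smul ?_ hh'.aestronglyMeasurable.comp_snd
      exact (Measurable.mul (by fun_prop) hk.measurable).aestronglyMeasurable
    · rw [Measure.prod_restrict]
      refine (ae_restrict_iff' (measurableSet_Ioc.prod measurableSet_Ioc)).2
        (Eventually.of_forall fun p hp => ?_)
      simp only [Function.uncurry_def, norm_smul, norm_mul, Real.norm_eq_abs]
      have h1 := abs_heaviside_le_one (p.2 - p.1)
      have h2 : |k p.1 p.2| ≤ C := hC p ⟨Ioc_subset_Icc_self hp.1, Ioc_subset_Icc_self hp.2⟩
      gcongr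
      calc |heaviside (p.2 - p.1)| * |k p.1 p.2| ≤ 1 * |k p.1 p.2| := by gcongr
        _ ≤ C := by rwa [one_mul]
  refine ⟨?_, ?_⟩
  · rw [intervalIntegrable_iff_integrableOn_Ioc_of_le ht]
    simp only [intervalIntegral.integral_of_le ht]
    exact hint.integral_prod_left
  · simp only [intervalIntegral.integral_of_le ht]
    rw [integral_integral_swap hint]
    refine setIntegral_congr_fun measurableSet_Ioc fun s hs => ?_
    rw [integral_smul_const]
    congr 1
    rw [intervalIntegral.integral_of_le hs.1.le,
      ← inter_eq_right.2 (Ioc_subset_Ioc_right hs.2 : Ioc 0 s ⊆ Ioc 0 t),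
      ← setIntegral_indicator measurableSet_Ioc]
    refine setIntegral_congr_fun measurableSet_Ioc fun r hr => ?_
    by_cases hrs : r ≤ s
    · simp [indicator, hr.1, hrs, heaviside_of_nonneg (sub_nonneg.2 hrs)]
    · simp [indicator, hrs, heaviside_of_neg (sub_neg.2 (not_le.1 hrs))]

/-- The value at distance `r` from the origin of the retarded Klein-Gordon field at time `t` with
source `g(t) δ(x)`. -/
def kgProfile (m : ℝ) (g : ℝ → E) (t r : ℝ) : E :=
  (heaviside (t - r) / (4 * π * r)) • g (t - r)
    - (m / (4 * π)) • ∫ s in (0 : ℝ)..t,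
      (heaviside (s - r) * (m / 2 * besselEntire 1 ((m / 2) ^ 2 * (s ^ 2 - r ^ 2)))) • g (t - s)

theorem kgProfile_eq_zero (m : ℝ) (g : ℝ → E) {t r : ℝ} (ht : 0 ≤ t) (hr : t < r) :
    kgProfile m g t r = 0 := by
  unfold kgProfile
  rw [heaviside_of_neg (by linarith), intervalIntegral.integral_congr (g := fun _ => (0 : E))]
  · simp
  · intro s hs
    rw [uIcc_of_le ht] at hs
    simp [heaviside_of_neg (by linarith [hs.2] : s - r < 0)]

theorem stronglyMeasurable_kgProfile (m : ℝ) {g : ℝ → E} (hg : Continuous g) {t : ℝ} (ht : 0 ≤ t) :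
    StronglyMeasurable (kgProfile m g t) := by
  unfold kgProfile
  refine StronglyMeasurable.sub ?_ (StronglyMeasurable.const_smul ?_ _)
  · refine StronglyMeasurable.smul ?_ (Continuous.stronglyMeasurable (by fun_prop))
    exact Measurable.stronglyMeasurable (by fun_prop)
  · simp only [intervalIntegral.integral_of_le ht]
    refine StronglyMeasurable.integral_prod_right (f := fun r s =>
      (heaviside (s - r) * (m / 2 * besselEntire 1 ((m / 2) ^ 2 * (s ^ 2 - r ^ 2)))) • g (t - s)) ?_
    simp only [Function.uncurry_def]
    refine StronglyMeasurable.smul (Measurable.stronglyMeasurable ?_)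
      (Continuous.stronglyMeasurable (by fun_prop))
    exact Measurable.mul (by fun_prop) (Continuous.measurable (by fun_prop))

/-- The field is `O(1/r)` and supported in the light cone `r ≤ t`. -/
theorem exists_norm_smul_kgProfile_le (m : ℝ) {g : ℝ → E} (hg : Continuous g) {t : ℝ}
    (ht : 0 ≤ t) : ∃ C : ℝ, 0 ≤ C ∧ ∀ r : ℝ, 0 < r →
      ‖r • kgProfile m g t r‖ ≤ (Ioc 0 t).indicator (fun _ => C) r := by
  obtain ⟨G, hG⟩ := (isCompact_Icc (a := 0) (b := t)).exists_bound_of_continuousOn hg.continuousOn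
  have hk : Continuous fun p : ℝ × ℝ =>
    m / 2 * besselEntire 1 ((m / 2) ^ 2 * (p.2 ^ 2 - p.1 ^ 2)) := by fun_prop
  obtain ⟨B, hB⟩ := ((isCompact_Icc (a := 0) (b := t)).prod
    (isCompact_Icc (a := 0) (b := t))).exists_bound_of_continuousOn hk.continuousOn
  have hG0 : 0 ≤ G := (norm_nonneg _).trans (hG 0 ⟨le_rfl, ht⟩)
  have hB0 : 0 ≤ B := (norm_nonneg _).trans (hB (0, 0) ⟨⟨le_rfl, ht⟩, ⟨le_rfl, ht⟩⟩)
  refine ⟨1 / (4 * π) * G + t * (|m| / (4 * π) * (B * G * t)), by positivity, fun r hr => ?_⟩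
  by_cases hrt : r ≤ t
  · simp only [indicator, mem_Ioc, hr, hrt, and_self, if_true]
    have h2 : ‖∫ s in (0 : ℝ)..t, (heaviside (s - r) *
        (m / 2 * besselEntire 1 ((m / 2) ^ 2 * (s ^ 2 - r ^ 2)))) • g (t - s)‖ ≤ B * G * t := by
      refine (intervalIntegral.norm_integral_le_of_norm_le_const (C := B * G) fun s hs => ?_).trans
        (by simp [abs_of_nonneg ht])
      rw [uIoc_of_le ht] at hs
      rw [norm_smul, norm_mul]
      have h3 := abs_heaviside_le_one (s - r)
      have h4 := hB (r, s) ⟨⟨hr.le, hrt⟩, Ioc_subset_Icc_self hs⟩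
      have h5 := hG (t - s) ⟨by linarith [hs.2], by linarith [hs.1]⟩
      refine mul_le_mul ?_ h5 (norm_nonneg _) hB0
      exact (mul_le_of_le_one_left (norm_nonneg _) h3).trans h4
    unfold kgProfile
    rw [smul_sub, smul_smul]
    refine (norm_sub_le _ _).trans (add_le_add ?_ ?_)
    · have h5 := hG (t - r) ⟨by linarith, by linarith⟩
      rw [norm_smul, heaviside_of_nonneg (by linarith)]
      have : r * (1 / (4 * π * r)) = 1 / (4 * π) := by field_simp
      rw [this, Real.norm_of_nonneg (by positivity)]
      gcongr
    · rw [norm_smul, norm_smul, Real.norm_of_nonneg hr.le, norm_div, Real.norm_eq_abs m,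
        Real.norm_of_nonneg (by positivity : (0 : ℝ) ≤ 4 * π)]
      gcongr
  · rw [kgProfile_eq_zero m g ht (not_le.1 hrt)]
    simp [indicator, hrt]

theorem integrableOn_of_norm_le_indicator {F : Type*} [NormedAddCommGroup F] {t C : ℝ} {u : ℝ → F}
    (hu : AEStronglyMeasurable u (volume.restrict (Ioi 0)))
    (h : ∀ r : ℝ, 0 < r → ‖u r‖ ≤ (Ioc 0 t).indicator (fun _ => C) r) :
    IntegrableOn u (Ioi 0) := by
  have hi : Integrable ((Ioc 0 t).indicator (fun _ : ℝ => C)) :=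
    (integrable_indicator_iff measurableSet_Ioc).2
      (continuous_const.integrableOn_Icc.mono_set Ioc_subset_Icc_self)
  exact hi.integrableOn.mono' hu
    ((ae_restrict_iff' measurableSet_Ioi).2 (Eventually.of_forall fun r hr => h r hr))

theorem memLp_two_radial_space3 {P : ℝ → E} (hP : StronglyMeasurable P) :
    MemLp (fun x : Space3 => P ‖x‖) 2 (volume : Measure Space3) ↔
      IntegrableOn (fun r => ‖r • P r‖ ^ 2) (Ioi (0 : ℝ)) := by
  have hm : AEStronglyMeasurable (fun x : Space3 => P ‖x‖) volume :=
    (hP.comp_measurable measurable_norm).aestronglyMeasurable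
  rw [memLp_two_iff_integrable_sq_norm hm,
    integrable_radial_space3 (P := fun r => ‖P r‖ ^ 2)]
  refine integrable_congr (Eventually.of_forall fun r => ?_)
  simp [norm_smul, mul_pow]

theorem integrable_kgProfile_norm (m : ℝ) {g : ℝ → E} (hg : Continuous g) {t : ℝ} (ht : 0 ≤ t) :
    Integrable fun x : Space3 => kgProfile m g t ‖x‖ := by
  obtain ⟨C, hC0, hC⟩ := exists_norm_smul_kgProfile_le m hg ht
  rw [integrable_radial_space3]
  refine integrableOn_of_norm_le_indicator (t := t) (C := t * C) ?_ fun r hr => ?_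
  · exact (continuous_id.pow 2).aestronglyMeasurable.smul
      (stronglyMeasurable_kgProfile m hg ht).aestronglyMeasurable
  · rw [pow_two, mul_smul, norm_smul, Real.norm_of_nonneg hr.le]
    have h := hC r hr
    by_cases hrt : r ≤ t
    · simp only [indicator, mem_Ioc, hr, hrt, and_self, if_true] at h ⊢
      gcongr
    · rw [kgProfile_eq_zero m g ht (not_le.1 hrt)]
      simp [indicator, hrt]

theorem memLp_kgProfile_norm (m : ℝ) {g : ℝ → E} (hg : Continuous g) {t : ℝ} (ht : 0 ≤ t) :
    MemLp (fun x : Space3 => kgProfile m g t ‖x‖) 2 (volume : Measure Space3) := by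
  obtain ⟨C, hC0, hC⟩ := exists_norm_smul_kgProfile_le m hg ht
  rw [memLp_two_radial_space3 (stronglyMeasurable_kgProfile m hg ht)]
  refine integrableOn_of_norm_le_indicator (t := t) (C := C ^ 2) ?_ fun r hr => ?_
  · exact ((continuous_id.aestronglyMeasurable.smul
      (stronglyMeasurable_kgProfile m hg ht).aestronglyMeasurable).norm.pow 2)
  · rw [norm_pow, norm_norm]
    refine (pow_le_pow_left₀ (norm_nonneg _) (hC r hr) 2).trans_eq ?_
    by_cases hrt : r ≤ t <;> simp [indicator, hr, hrt]

/-- Integration by parts in `r`, which turns the kernel `J₁` into `J₀`. -/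
theorem sub_integral_mul_besselEntire_one (m s : ℝ) {f f' : ℝ → ℝ}
    (hf : ∀ r, HasDerivAt f (f' r) r) (hf' : Continuous f') :
    f s - ∫ r in (0 : ℝ)..s, m * r * f r * (m / 2 * besselEntire 1 ((m / 2) ^ 2 * (s ^ 2 - r ^ 2)))
      = f 0 * besselJ 0 (m * s)
        + ∫ r in (0 : ℝ)..s, f' r * besselEntire 0 ((m / 2) ^ 2 * (s ^ 2 - r ^ 2)) := by
  have hfc : Continuous f := continuous_iff_continuousAt.2 fun r => (hf r).continuousAt
  have hd : ∀ r ∈ uIcc 0 s, HasDerivAt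
      (fun r => f r * besselEntire 0 ((m / 2) ^ 2 * (s ^ 2 - r ^ 2)))
      (f' r * besselEntire 0 ((m / 2) ^ 2 * (s ^ 2 - r ^ 2))
        + m * r * f r * (m / 2 * besselEntire 1 ((m / 2) ^ 2 * (s ^ 2 - r ^ 2)))) r := by
    intro r _
    have h := (hf r).mul ((hasDerivAt_besselEntire 0 ((m / 2) ^ 2 * (s ^ 2 - r ^ 2))).comp r
      (((hasDerivAt_pow 2 r).const_sub (s ^ 2)).const_mul ((m / 2) ^ 2)))
    refine h.congr_deriv ?_
    simp
    ring
  have h := intervalIntegral.integral_eq_sub_of_hasDerivAt hd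
    (Continuous.intervalIntegrable (by fun_prop) _ _)
  rw [intervalIntegral.integral_add (Continuous.intervalIntegrable (by fun_prop) _ _)
    (Continuous.intervalIntegrable (by fun_prop) _ _)] at h
  have e : besselJ 0 (m * s) = besselEntire 0 ((m / 2) ^ 2 * (s ^ 2 - 0 ^ 2)) := by
    rw [besselJ_zero_eq]; congr 1; ring
  rw [e]
  simp only [sub_self, mul_zero, besselEntire_zero, Nat.factorial_zero, Nat.cast_one, div_one,
    mul_one] at h
  linarith

/-- The pairing of a radial weight `f(r)/r` with the retarded field. -/
theorem integral_smul_kgProfile [CompleteSpace E] (m : ℝ) {g : ℝ → E} (hg : Continuous g) {t : ℝ}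
    (ht : 0 ≤ t) {f f' : ℝ → ℝ} (hf : ∀ r, HasDerivAt f (f' r) r) (hf' : Continuous f') :
    ∫ r in Ioi (0 : ℝ), (4 * π * r * f r) • kgProfile m g t r
      = ∫ s in (0 : ℝ)..t, (f 0 * besselJ 0 (m * s)
          + ∫ r in (0 : ℝ)..s, f' r * besselEntire 0 ((m / 2) ^ 2 * (s ^ 2 - r ^ 2))) •
            g (t - s) := by
  have hfc : Continuous f := continuous_iff_continuousAt.2 fun r => (hf r).continuousAt
  set k : ℝ → ℝ → ℝ := fun r s =>
    m * r * f r * (m / 2 * besselEntire 1 ((m / 2) ^ 2 * (s ^ 2 - r ^ 2))) with hk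
  have hkc : Continuous (Function.uncurry k) := by
    simp only [hk, Function.uncurry_def]; fun_prop
  have hgi : IntervalIntegrable (fun s => g (t - s)) volume 0 t :=
    Continuous.intervalIntegrable (by fun_prop) _ _
  obtain ⟨hsw1, hsw2⟩ := integral_heaviside_smul_swap hkc ht hgi
  have h1 : ∫ r in Ioi (0 : ℝ), (4 * π * r * f r) • kgProfile m g t r
      = ∫ r in (0 : ℝ)..t, (4 * π * r * f r) • kgProfile m g t r := by
    rw [intervalIntegral.integral_of_le ht]
    refine setIntegral_eq_of_subset_of_forall_sdiff_eq_zero measurableSet_Ioi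
      (fun r hr => hr.1) fun r hr => ?_
    have hrt : t < r := not_le.1 fun h => hr.2 ⟨hr.1, h⟩
    rw [kgProfile_eq_zero m g ht hrt, smul_zero]
  have h2 : ∫ r in (0 : ℝ)..t, (4 * π * r * f r) • kgProfile m g t r
      = ∫ r in (0 : ℝ)..t, (f r • g (t - r)
        - ∫ s in (0 : ℝ)..t, (heaviside (s - r) * k r s) • g (t - s)) := by
    refine intervalIntegral.integral_congr_ae (Eventually.of_forall fun r hr => ?_)
    rw [uIoc_of_le ht] at hr
    have hr0 : r ≠ 0 := hr.1.ne'
    rw [kgProfile, smul_sub, smul_smul, smul_smul, heaviside_of_nonneg (by linarith [hr.2]),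
      ← intervalIntegral.integral_smul]
    congr 1
    · congr 1
      field_simp
    · refine intervalIntegral.integral_congr fun s _ => ?_
      simp only [smul_smul, hk]
      congr 1
      field_simp
  have hks : Continuous fun s => ∫ r in (0 : ℝ)..s, k r s :=
    intervalIntegral.continuous_parametric_intervalIntegral_of_continuous (μ := volume)
      (f := fun s r => k r s) (hkc.comp continuous_swap) continuous_id
  rw [h1, h2, intervalIntegral.integral_sub (Continuous.intervalIntegrable (by fun_prop) _ _) hsw1,
    hsw2, ← intervalIntegral.integral_sub (Continuous.intervalIntegrable (by fun_prop) _ _)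
      (Continuous.intervalIntegrable (by fun_prop) _ _)]
  refine intervalIntegral.integral_congr fun s _ => ?_
  simp only [← sub_smul, hk, sub_integral_mul_besselEntire_one m s hf hf']

end

/-- The Fourier transform of the retarded field is `∫₀ᵗ sin(ω s)/ω g(t - s) ds`, for
`ω = √(4π²|ξ|² + m²)`. -/
theorem fourier_kgProfile_norm {E : Type*} [NormedAddCommGroup E] [NormedSpace ℂ E]
    [CompleteSpace E] {m : ℝ} (hm : 0 < m) {g : ℝ → E} (hg : Continuous g) {t : ℝ} (ht : 0 ≤ t)
    {ξ : Space3} (hξ : ξ ≠ 0) :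
    𝓕 (fun x : Space3 => kgProfile m g t ‖x‖) ξ
      = ∫ s in (0 : ℝ)..t, (Real.sin (√(kgSymbol m ξ) * s) / √(kgSymbol m ξ)) • g (t - s) := by
  have hn : 0 < ‖ξ‖ := norm_pos_iff.2 hξ
  have hκ : 2 * π * ‖ξ‖ ≠ 0 := by positivity
  have hd : ∀ r : ℝ, HasDerivAt (fun r => Real.sin (2 * π * ‖ξ‖ * r) / (2 * π * ‖ξ‖))
      (Real.cos (2 * π * ‖ξ‖ * r)) r := by
    intro r
    refine ((((hasDerivAt_id r).const_mul (2 * π * ‖ξ‖)).sin).div_const _).congr_deriv ?_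
    simp
    field_simp
  rw [fourier_radial_space3 (integrable_kgProfile_norm m hg ht) hξ,
    integral_smul_kgProfile m hg ht hd (by fun_prop)]
  refine intervalIntegral.integral_congr fun s _ => ?_
  have hpos := kgSymbol_pos hm ξ
  simp only [mul_zero, Real.sin_zero, zero_div, zero_mul, zero_add]
  rw [integral_cos_mul_besselEntire (Real.sqrt_pos.2 hpos) (by rw [Real.sq_sqrt hpos.le]; rfl)]

/-- Decay of the Fourier transform in time: one integration by parts, for a source with an
integrable derivative. -/
theorem exists_norm_integral_sin_smul_le {E : Type*} [NormedAddCommGroup E] [NormedSpace ℝ E]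
    [CompleteSpace E] {g η : ℝ → E} {t : ℝ} (ht : 0 ≤ t) (hη : IntervalIntegrable η volume 0 t)
    (hg : ∀ u ∈ Icc 0 t, g u = g 0 + ∫ s in (0 : ℝ)..u, η s) :
    ∃ C : ℝ, 0 ≤ C ∧ ∀ ω : ℝ, 0 < ω →
      ‖∫ s in (0 : ℝ)..t, (Real.sin (ω * s) / ω) • g (t - s)‖ ≤ C / ω ^ 2 := by
  have hη' : IntervalIntegrable (fun s => η (t - s)) volume 0 t := by
    have := hη.comp_sub_left t
    simpa using this.symm
  refine ⟨2 * ‖g 0‖ + 2 * ∫ s in (0 : ℝ)..t, ‖η (t - s)‖, ?_, fun ω hω => ?_⟩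
  · have := intervalIntegral.integral_nonneg_of_forall (μ := volume) ht
      fun s => norm_nonneg (η (t - s))
    positivity
  -- the primitive of `sin(ω s)/ω` gains a second factor `1/ω`
  have hprim : ∀ s, ∫ r in (0 : ℝ)..s, Real.sin (ω * r) / ω = (1 - Real.cos (ω * s)) / ω ^ 2 := by
    intro s
    rw [intervalIntegral.integral_div, intervalIntegral.integral_comp_mul_left _ hω.ne',
      integral_sin]
    simp
    field_simp
  have hprim2 : ∀ s, ‖∫ r in (0 : ℝ)..s, Real.sin (ω * r) / ω‖ ≤ 2 / ω ^ 2 := by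
    intro s
    rw [hprim, norm_div, Real.norm_of_nonneg (by positivity : (0 : ℝ) ≤ ω ^ 2)]
    gcongr
    rw [Real.norm_eq_abs, abs_le]
    constructor <;> linarith [Real.neg_one_le_cos (ω * s), Real.cos_le_one (ω * s)]
  have hkc : Continuous (Function.uncurry fun r _ : ℝ => Real.sin (ω * r) / ω) := by
    simp only [Function.uncurry_def]; fun_prop
  obtain ⟨hsw1, hsw2⟩ := integral_heaviside_smul_swap hkc ht hη'
  have h1 : ∫ s in (0 : ℝ)..t, (Real.sin (ω * s) / ω) • g (t - s)
      = ∫ s in (0 : ℝ)..t, ((Real.sin (ω * s) / ω) • g 0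
        + ∫ r in (0 : ℝ)..t, (heaviside (r - s) * (Real.sin (ω * s) / ω)) • η (t - r)) := by
    refine intervalIntegral.integral_congr fun s hs => ?_
    rw [uIcc_of_le ht] at hs
    rw [hg (t - s) ⟨by linarith [hs.2], by linarith [hs.1]⟩, smul_add]
    congr 1
    rw [← intervalIntegral.integral_smul]
    have hcv := intervalIntegral.integral_comp_sub_left (a := s) (b := t)
      (fun u => (Real.sin (ω * s) / ω) • η u) t
    rw [sub_self] at hcv
    rw [← hcv, intervalIntegral.integral_of_le hs.2, intervalIntegral.integral_of_le ht,
      ← integral_Icc_eq_integral_Ioc, ← integral_Icc_eq_integral_Ioc,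
      ← inter_eq_right.2 (Icc_subset_Icc_left hs.1 : Icc s t ⊆ Icc 0 t),
      ← setIntegral_indicator measurableSet_Icc]
    refine setIntegral_congr_fun measurableSet_Icc fun r hr => ?_
    by_cases hrs : s ≤ r
    · simp [indicator, hr.2, hrs, heaviside_of_nonneg (sub_nonneg.2 hrs)]
    · simp [indicator, hrs, heaviside_of_neg (sub_neg.2 (not_le.1 hrs))]
  rw [h1, intervalIntegral.integral_add (Continuous.intervalIntegrable (by fun_prop) _ _) hsw1,
    hsw2, intervalIntegral.integral_smul_const]
  refine (norm_add_le _ _).trans ?_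
  have e : (2 * ‖g 0‖ + 2 * ∫ s in (0 : ℝ)..t, ‖η (t - s)‖) / ω ^ 2
      = 2 / ω ^ 2 * ‖g 0‖ + ∫ s in (0 : ℝ)..t, 2 / ω ^ 2 * ‖η (t - s)‖ := by
    rw [intervalIntegral.integral_const_mul]; ring
  rw [e, norm_smul]
  refine add_le_add (mul_le_mul_of_nonneg_right (hprim2 t) (norm_nonneg _)) ?_
  refine intervalIntegral.norm_integral_le_of_norm_le ht
    (Eventually.of_forall fun s _ => ?_) (hη'.norm.const_mul _)
  rw [norm_smul]
  exact mul_le_mul_of_nonneg_right (hprim2 s) (norm_nonneg _)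

/-! ### The Yukawa potential and the smoothed field at the origin -/

/-- The Yukawa potential `e^{-m r} / (4π r)`, the fundamental solution of `-Δ + m²`. -/
def yukawa (m r : ℝ) : ℝ := Real.exp (-m * r) / (4 * π * r)

theorem measurable_yukawa (m : ℝ) : Measurable (yukawa m) := by
  unfold yukawa; fun_prop

section

variable {E : Type*} [NormedAddCommGroup E]

theorem integrable_yukawa_smul [NormedSpace ℝ E] {m : ℝ} (hm : 0 < m) (v : E) :
    Integrable fun x : Space3 => yukawa m ‖x‖ • v := by
  rw [integrable_radial_space3 (P := fun r => yukawa m r • v)]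
  have h : IntegrableOn (fun r : ℝ => 1 / (4 * π) * (r ^ (1 : ℝ) * Real.exp (-m * r ^ (1 : ℝ))))
      (Ioi 0) :=
    (integrableOn_rpow_mul_exp_neg_mul_rpow (by norm_num) (by norm_num) hm).const_mul _
  have h2 : IntegrableOn (fun r : ℝ => r ^ 2 * yukawa m r) (Ioi 0) := by
    refine h.congr_fun (fun r hr => ?_) measurableSet_Ioi
    have hr : r ≠ 0 := ne_of_gt hr
    simp only [Real.rpow_one, yukawa]
    field_simp
  exact (h2.smul_const v).congr (Eventually.of_forall fun r => mul_smul _ _ _)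

theorem memLp_yukawa_smul [NormedSpace ℝ E] {m : ℝ} (hm : 0 < m) (v : E) :
    MemLp (fun x : Space3 => yukawa m ‖x‖ • v) 2 (volume : Measure Space3) := by
  rw [memLp_two_radial_space3 (P := fun r => yukawa m r • v)
    ((measurable_yukawa m).stronglyMeasurable.smul_const v)]
  have h : IntegrableOn (fun r => (1 / (4 * π)) ^ 2 * ‖v‖ ^ 2 * Real.exp (-(2 * m) * r))
      (Ioi 0) := (exp_neg_integrableOn_Ioi 0 (by linarith : 0 < 2 * m)).const_mul _
  refine h.congr_fun (fun r hr => ?_) measurableSet_Ioi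
  have hr : 0 < r := hr
  have e : Real.exp (-(2 * m) * r) = Real.exp (-m * r) ^ 2 := by
    rw [← Real.exp_nat_mul]; congr 1; push_cast; ring
  simp only [yukawa]
  rw [smul_smul, norm_smul, mul_pow, e, Real.norm_of_nonneg (by positivity)]
  field_simp

theorem integral_exp_neg_mul_sin {m : ℝ} (hm : 0 < m) (κ : ℝ) :
    ∫ r in Ioi (0 : ℝ), Real.exp (-m * r) * Real.sin (κ * r) = κ / (κ ^ 2 + m ^ 2) := by
  have hpos : 0 < κ ^ 2 + m ^ 2 := by positivity
  have hd : ∀ r ∈ Ici (0 : ℝ), HasDerivAt (fun r => -(Real.exp (-m * r) *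
      ((m * Real.sin (κ * r) + κ * Real.cos (κ * r)) / (κ ^ 2 + m ^ 2))))
      (Real.exp (-m * r) * Real.sin (κ * r)) r := by
    intro r _
    have h1 := ((hasDerivAt_id r).const_mul (-m)).exp
    have h2 := ((((hasDerivAt_id r).const_mul κ).sin).const_mul m).add
      ((((hasDerivAt_id r).const_mul κ).cos).const_mul κ)
    refine ((h1.mul (h2.div_const (κ ^ 2 + m ^ 2))).neg).congr_deriv ?_
    simp
    field_simp
    ring
  have hexp : Tendsto (fun r : ℝ => Real.exp (-m * r)) atTop (𝓝 0) :=
    Real.tendsto_exp_atBot.comp (tendsto_id.const_mul_atTop_of_neg (neg_lt_zero.2 hm))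
  have hlim : Tendsto (fun r => -(Real.exp (-m * r) *
      ((m * Real.sin (κ * r) + κ * Real.cos (κ * r)) / (κ ^ 2 + m ^ 2)))) atTop (𝓝 0) := by
    rw [← neg_zero]
    refine (hexp.zero_mul_isBoundedUnder_le
      (isBoundedUnder_of ⟨(m + |κ|) / (κ ^ 2 + m ^ 2), fun r => ?_⟩)).neg
    simp only [Function.comp_apply]
    rw [norm_div, Real.norm_of_nonneg hpos.le, Real.norm_eq_abs]
    gcongr
    refine (abs_add_le _ _).trans (add_le_add ?_ ?_)
    · rw [abs_mul, abs_of_pos hm]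
      exact mul_le_of_le_one_right hm.le (Real.abs_sin_le_one _)
    · rw [abs_mul]
      exact mul_le_of_le_one_right (abs_nonneg _) (Real.abs_cos_le_one _)
  have hint : IntegrableOn (fun r => Real.exp (-m * r) * Real.sin (κ * r)) (Ioi 0) := by
    refine (exp_neg_integrableOn_Ioi 0 hm).mono'
      (Continuous.aestronglyMeasurable (by fun_prop)) (Eventually.of_forall fun r => ?_)
    rw [norm_mul, Real.norm_of_nonneg (Real.exp_pos _).le]
    exact mul_le_of_le_one_right (Real.exp_pos _).le (Real.abs_sin_le_one _)
  rw [integral_Ioi_of_hasDerivAt_of_tendsto' hd hint hlim]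
  simp

theorem fourier_yukawa_smul [NormedSpace ℂ E] [CompleteSpace E] {m : ℝ} (hm : 0 < m) (v : E)
    {ξ : Space3} (hξ : ξ ≠ 0) :
    𝓕 (fun x : Space3 => yukawa m ‖x‖ • v) ξ = (kgSymbol m ξ)⁻¹ • v := by
  have hn : 0 < ‖ξ‖ := norm_pos_iff.2 hξ
  rw [fourier_radial_space3 (P := fun r => yukawa m r • v) (integrable_yukawa_smul hm v) hξ]
  have e : ∫ r in Ioi (0 : ℝ), (4 * π * r * (Real.sin (2 * π * ‖ξ‖ * r) / (2 * π * ‖ξ‖))) •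
      (yukawa m r • v) = ∫ r in Ioi (0 : ℝ), ((2 * π * ‖ξ‖)⁻¹ *
        (Real.exp (-m * r) * Real.sin (2 * π * ‖ξ‖ * r))) • v := by
    refine setIntegral_congr_fun measurableSet_Ioi fun r hr => ?_
    have hr : r ≠ 0 := ne_of_gt hr
    simp only [smul_smul, yukawa]
    congr 1
    field_simp
  rw [e, integral_smul_const, integral_const_mul, integral_exp_neg_mul_sin hm]
  congr 1
  rw [kgSymbol]
  field_simp

end

theorem ae_ne_zero_space3 : ∀ᵐ ξ : Space3, ξ ≠ 0 :=
  compl_mem_ae_iff.2 (measure_singleton 0)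

/-- `(-Δ + m²)⁻¹ p` at the origin, computed on both sides of the Fourier transform. -/
theorem integral_kgSymbol_inv_smul_fourier {E : Type*} [NormedAddCommGroup E]
    [InnerProductSpace ℂ E] [CompleteSpace E] {m : ℝ} (hm : 0 < m) {p : Space3 → E}
    (hp1 : Integrable p) (hp2 : MemLp p 2 (volume : Measure Space3))
    (hF : Integrable fun ξ => (kgSymbol m ξ)⁻¹ • 𝓕 p ξ) :
    ∫ ξ, (kgSymbol m ξ)⁻¹ • 𝓕 p ξ = ∫ x : Space3, yukawa m ‖x‖ • p x := by
  have hY : Integrable fun x : Space3 => yukawa m ‖x‖ • p x := by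
    have h1 : MemLp (fun x : Space3 => yukawa m ‖x‖) 2 (volume : Measure Space3) := by
      simpa using memLp_yukawa_smul hm (1 : ℝ)
    have h2 : MemLp (fun x : Space3 => yukawa m ‖x‖ • p x) 1 (volume : Measure Space3) :=
      MemLp.smul (𝕜 := ℝ) hp2 h1
    exact memLp_one_iff_integrable.1 h2
  refine ext_inner_left ℂ fun v => ?_
  rw [← integral_inner hF, ← integral_inner hY]
  have hv1 := integrable_yukawa_smul (E := E) hm v
  have hv2 := memLp_yukawa_smul (E := E) hm v
  have h := Lp.inner_fourier_eq (hv2.toLp _) (hp2.toLp p)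
  rw [L2.inner_def, L2.inner_def] at h
  have h1 : ∫ ξ, inner ℂ ((𝓕 (hv2.toLp _) : Lp E 2 (volume : Measure Space3)) ξ)
      ((𝓕 (hp2.toLp p) : Lp E 2 (volume : Measure Space3)) ξ)
      = ∫ ξ, inner ℂ v ((kgSymbol m ξ)⁻¹ • 𝓕 p ξ) := by
    refine integral_congr_ae ?_
    filter_upwards [coeFn_fourier_toLp hv1 hv2, coeFn_fourier_toLp hp1 hp2, ae_ne_zero_space3]
      with ξ hξ1 hξ2 hξ0
    rw [hξ1, hξ2, fourier_yukawa_smul hm v hξ0, ← Complex.coe_smul, ← Complex.coe_smul,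
      inner_smul_left, inner_smul_right, Complex.conj_ofReal]
  have h2 : ∫ x, inner ℂ ((hv2.toLp _) x) ((hp2.toLp p) x)
      = ∫ x, inner ℂ v (yukawa m ‖x‖ • p x) := by
    refine integral_congr_ae ?_
    filter_upwards [hv2.coeFn_toLp, hp2.coeFn_toLp] with x hx1 hx2
    rw [hx1, hx2, ← Complex.coe_smul, ← Complex.coe_smul,
      inner_smul_left, inner_smul_right, Complex.conj_ofReal]
  rw [← h1, ← h2, h]

theorem continuous_kgSymbol (m : ℝ) : Continuous (kgSymbol m) := by
  unfold kgSymbol; fun_prop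

theorem integrable_kgSymbol_rpow {m : ℝ} (hm : 0 < m) {a : ℝ} (ha : 3 / 2 < a) :
    Integrable fun ξ : Space3 => kgSymbol m ξ ^ (-a) := by
  have h := integrable_rpow_neg_one_add_norm_sq (E := Space3) (μ := volume) (r := 2 * a)
    (by simp; linarith)
  set c : ℝ := min (m ^ 2) ((2 * π) ^ 2) with hc
  have hc0 : 0 < c := lt_min (by positivity) (by positivity)
  refine (h.const_mul (c ^ (-a))).mono'
    ((continuous_kgSymbol m).rpow_const fun ξ =>
      Or.inl (kgSymbol_pos hm ξ).ne').aestronglyMeasurable (Eventually.of_forall fun ξ => ?_)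
  have h1 : c * (1 + ‖ξ‖ ^ 2) ≤ kgSymbol m ξ := by
    have h2 : c ≤ m ^ 2 := min_le_left _ _
    have h3 : c ≤ (2 * π) ^ 2 := min_le_right _ _
    unfold kgSymbol
    nlinarith [mul_le_mul_of_nonneg_right h3 (sq_nonneg ‖ξ‖)]
  rw [Real.norm_of_nonneg (Real.rpow_nonneg (kgSymbol_pos hm ξ).le _),
    show -(2 * a) / 2 = -a by ring, ← Real.mul_rpow hc0.le (by positivity)]
  exact Real.rpow_le_rpow_of_nonpos (by positivity) h1 (by linarith)

theorem matAct_diracSymbol_inv_apply {α : Fin 3 → Matrix (Fin 4) (Fin 4) ℂ}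
    {β : Matrix (Fin 4) (Fin 4) ℂ} (hD : IsDiracMatrices α β) {m : ℝ} (hm : 0 < m)
    (ξ : Space3) (v : Spinor) :
    matAct (diracSymbol α β m ξ)⁻¹ v = (kgSymbol m ξ)⁻¹ •
      (∑ k, (2 * π * ξ k) • matAct (α k) v + m • matAct β v) := by
  have e : matAct (((kgSymbol m ξ : ℂ)⁻¹) • diracSymbol α β m ξ) = ((kgSymbol m ξ : ℂ)⁻¹) •
      (∑ k, ((2 * π * ξ k : ℝ) : ℂ) • matAct (α k) + (m : ℂ) • matAct β) := by
    simp only [matAct, diracSymbol, map_smul, map_add, map_sum]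
  rw [diracSymbol_inv hD hm, e, ← Complex.ofReal_inv]
  simp only [Complex.coe_smul, smul_apply, add_apply, sum_apply]

theorem norm_matAct_diracSymbol_inv_apply_le {α : Fin 3 → Matrix (Fin 4) (Fin 4) ℂ}
    {β : Matrix (Fin 4) (Fin 4) ℂ} (hD : IsDiracMatrices α β) {m : ℝ} (hm : 0 < m)
    (ξ : Space3) (v : Spinor) :
    ‖matAct (diracSymbol α β m ξ)⁻¹ v‖
      ≤ kgSymbol m ξ ^ (-(1 / 2) : ℝ) * ((∑ k, ‖matAct (α k)‖ + ‖matAct β‖) * ‖v‖) := by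
  have hpos := kgSymbol_pos hm ξ
  set w : ℝ := √(kgSymbol m ξ) with hw
  have hw2 : w * w = kgSymbol m ξ := Real.mul_self_sqrt hpos.le
  have hw0 : 0 < w := Real.sqrt_pos.2 hpos
  have hwm : |m| ≤ w := by
    apply Real.abs_le_sqrt
    unfold kgSymbol; nlinarith [sq_nonneg (2 * π * ‖ξ‖)]
  have hwx : ∀ k, |2 * π * ξ k| ≤ w := by
    intro k
    apply Real.abs_le_sqrt
    have h1 : |ξ k| ≤ ‖ξ‖ := by simpa using PiLp.norm_apply_le ξ k
    have h3 := pow_le_pow_left₀ (abs_nonneg _) h1 2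
    rw [sq_abs] at h3
    unfold kgSymbol
    rw [mul_pow, mul_pow _ ‖ξ‖]
    nlinarith [sq_nonneg m, mul_le_mul_of_nonneg_left h3 (sq_nonneg (2 * π))]
  have hr : kgSymbol m ξ ^ (-(1 / 2) : ℝ) = w⁻¹ := by
    rw [Real.rpow_neg hpos.le, ← Real.sqrt_eq_rpow]
  rw [matAct_diracSymbol_inv_apply hD hm, norm_smul, hr, norm_inv, Real.norm_of_nonneg hpos.le,
    ← hw2, mul_inv, mul_assoc]
  refine mul_le_mul_of_nonneg_left ?_ (by positivity)
  rw [inv_mul_le_iff₀ hw0, add_mul, mul_add, Finset.sum_mul, Finset.mul_sum]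
  refine (norm_add_le _ _).trans (add_le_add ((norm_sum_le _ _).trans
    (Finset.sum_le_sum fun k _ => ?_)) ?_)
  · rw [norm_smul]
    exact mul_le_mul (hwx k) (ContinuousLinearMap.le_opNorm _ _) (norm_nonneg _) hw0.le
  · rw [norm_smul]
    exact mul_le_mul hwm (ContinuousLinearMap.le_opNorm _ _) (norm_nonneg _) hw0.le

theorem smoothingIntegrand_diracInv_ae_eq {α : Fin 3 → Matrix (Fin 4) (Fin 4) ℂ}
    {β : Matrix (Fin 4) (Fin 4) ℂ} (hD : IsDiracMatrices α β) {m : ℝ} (hm : 0 < m) (ε : ℝ)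
    {p : Space3 → Spinor} (hp1 : Integrable p) (hp2 : MemLp p 2 (volume : Measure Space3)) :
    smoothingIntegrand m ε (diracInv hD hm (hp2.toLp p)) =ᵐ[volume]
      fun ξ => kgSymbol m ξ ^ (-ε) • matAct (diracSymbol α β m ξ)⁻¹ (𝓕 p ξ) := by
  have h := (memLp_diracSymbol_inv hD hm (𝓕 (hp2.toLp p))).coeFn_toLp
  filter_upwards [h, coeFn_fourier_toLp hp1 hp2] with ξ h1 h2
  rw [smoothingIntegrand, diracInv, FourierInvPair.fourier_fourierInv_eq, h1, h2]

/-- For a source field `p` whose Fourier transform is even and `O((|ξ|² + m²)⁻¹)`, the smoothed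
field `K^ε D⁻¹ p` has a limit at the origin. The part `α·ξ` of the symbol is odd and drops out,
and what remains is integrable uniformly in `ε`. -/
theorem tendsto_smoothing_diracInv {α : Fin 3 → Matrix (Fin 4) (Fin 4) ℂ}
    {β : Matrix (Fin 4) (Fin 4) ℂ} (hD : IsDiracMatrices α β) {m : ℝ} (hm : 0 < m)
    {p : Space3 → Spinor} (hp1 : Integrable p) (hp2 : MemLp p 2 (volume : Measure Space3))
    (heven : ∀ ξ, 𝓕 p (-ξ) = 𝓕 p ξ) {C : ℝ} (hC : ∀ᵐ ξ, ‖𝓕 p ξ‖ ≤ C * (kgSymbol m ξ)⁻¹) :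
    (∀ ε : ℝ, 0 < ε → Integrable (smoothingIntegrand m ε (diracInv hD hm (hp2.toLp p)))) ∧
    (∀ ε : ℝ, 0 < ε → Tendsto (smoothing m ε (diracInv hD hm (hp2.toLp p))) (𝓝 0)
      (𝓝 (m • matAct β (∫ ξ, kgSymbol m ξ ^ (-ε) • (kgSymbol m ξ)⁻¹ • 𝓕 p ξ)))) ∧
    Integrable (fun ξ => (kgSymbol m ξ)⁻¹ • 𝓕 p ξ) ∧
    Tendsto (fun ε : ℝ => m • matAct β (∫ ξ, kgSymbol m ξ ^ (-ε) • (kgSymbol m ξ)⁻¹ • 𝓕 p ξ))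
      (𝓝[>] 0) (𝓝 (m • matAct β (∫ ξ, (kgSymbol m ξ)⁻¹ • 𝓕 p ξ))) := by
  have hpos := fun ξ => kgSymbol_pos hm ξ
  have hFc : Continuous (𝓕 p) := VectorFourier.fourierIntegral_continuous
    Real.continuous_fourierChar (innerSL ℝ).continuous₂ hp1
  have hrc : ∀ a : ℝ, Continuous fun ξ => kgSymbol m ξ ^ a := fun a =>
    (continuous_kgSymbol m).rpow_const fun ξ => Or.inl (hpos ξ).ne'
  have hic : Continuous fun ξ => (kgSymbol m ξ)⁻¹ :=
    (continuous_kgSymbol m).inv₀ fun ξ => (hpos ξ).ne'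
  have hint : ∀ ε : ℝ, 0 < ε → Integrable fun ξ =>
      kgSymbol m ξ ^ (-ε) • matAct (diracSymbol α β m ξ)⁻¹ (𝓕 p ξ) := by
    intro ε hε
    set A := ∑ k, ‖matAct (α k)‖ + ‖matAct β‖ with hA
    have hA0 : 0 ≤ A := by positivity
    refine ((integrable_kgSymbol_rpow hm (by linarith : 3 / 2 < ε + 3 / 2)).const_mul
      (A * C)).mono' ?_ ?_
    · refine ((hrc _).smul ?_).aestronglyMeasurable
      simp only [matAct_diracSymbol_inv_apply hD hm]
      fun_prop
    · filter_upwards [hC] with ξ hξ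
      rw [norm_smul, Real.norm_of_nonneg (Real.rpow_nonneg (hpos ξ).le _)]
      have e : A * C * kgSymbol m ξ ^ (-(ε + 3 / 2)) = kgSymbol m ξ ^ (-ε) *
          (kgSymbol m ξ ^ (-(1 / 2) : ℝ) * (A * (C * (kgSymbol m ξ)⁻¹))) := by
        rw [← Real.rpow_neg_one, show -(ε + 3 / 2) = -ε + (-(1 / 2) + -1) by ring,
          Real.rpow_add (hpos ξ), Real.rpow_add (hpos ξ)]
        ring
      rw [e]
      refine mul_le_mul_of_nonneg_left ((norm_matAct_diracSymbol_inv_apply_le hD hm ξ _).trans ?_)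
        (Real.rpow_nonneg (hpos ξ).le _)
      have := Real.rpow_nonneg (hpos ξ).le (-(1 / 2))
      gcongr
  have hint2 : ∀ ε : ℝ, 0 ≤ ε → Integrable fun ξ =>
      kgSymbol m ξ ^ (-ε) • (kgSymbol m ξ)⁻¹ • 𝓕 p ξ := by
    intro ε hε
    refine ((integrable_kgSymbol_rpow hm (by linarith : 3 / 2 < ε + 2)).const_mul C).mono'
      ((hrc _).smul (hic.smul hFc)).aestronglyMeasurable ?_
    filter_upwards [hC] with ξ hξ
    rw [norm_smul, norm_smul, Real.norm_of_nonneg (Real.rpow_nonneg (hpos ξ).le _), norm_inv,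
      Real.norm_of_nonneg (hpos ξ).le]
    have e : C * kgSymbol m ξ ^ (-(ε + 2)) = kgSymbol m ξ ^ (-ε) *
        ((kgSymbol m ξ)⁻¹ * (C * (kgSymbol m ξ)⁻¹)) := by
      rw [← Real.rpow_neg_one, show -(ε + 2) = -ε + (-1 + -1) by ring,
        Real.rpow_add (hpos ξ), Real.rpow_add (hpos ξ)]
      ring
    rw [e]
    have := Real.rpow_nonneg (hpos ξ).le (-ε)
    have := inv_nonneg.2 (hpos ξ).le
    gcongr
  have hint0 : Integrable (fun ξ => (kgSymbol m ξ)⁻¹ • 𝓕 p ξ) := by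
    simpa using hint2 0 le_rfl
  have hval : ∀ ε : ℝ, 0 < ε →
      ∫ ξ, kgSymbol m ξ ^ (-ε) • matAct (diracSymbol α β m ξ)⁻¹ (𝓕 p ξ)
        = m • matAct β (∫ ξ, kgSymbol m ξ ^ (-ε) • (kgSymbol m ξ)⁻¹ • 𝓕 p ξ) := by
    intro ε hε
    have hk : ∀ ξ, kgSymbol m (-ξ) = kgSymbol m ξ := fun ξ => by simp [kgSymbol]
    set F : Space3 → Spinor := fun ξ =>
      kgSymbol m ξ ^ (-ε) • matAct (diracSymbol α β m ξ)⁻¹ (𝓕 p ξ) with hF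
    have hsum : ∀ ξ, F ξ + F (-ξ) = (2 * m) • matAct β
        (kgSymbol m ξ ^ (-ε) • (kgSymbol m ξ)⁻¹ • 𝓕 p ξ) := by
      intro ξ
      simp only [hF, matAct_diracSymbol_inv_apply hD hm, hk, heven, ← Complex.coe_smul, map_smul]
      simp only [Complex.coe_smul, Fin.sum_univ_three, PiLp.neg_apply]
      module
    -- symmetrising the integrand removes the odd part `α·ξ` of the symbol
    have h1 : (2 : ℝ) • ∫ ξ, F ξ = ∫ ξ, (F ξ + F (-ξ)) := by
      have hi : Integrable F := hint ε hε
      rw [integral_add hi hi.comp_neg, integral_neg_eq_self F, two_smul]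
    simp only [hsum] at h1
    rw [integral_smul, ContinuousLinearMap.integral_comp_comm _ (hint2 ε hε.le), mul_smul] at h1
    exact smul_right_injective _ (two_ne_zero : (2 : ℝ) ≠ 0) h1
  refine ⟨fun ε hε => (hint ε hε).congr (smoothingIntegrand_diracInv_ae_eq hD hm ε hp1 hp2).symm,
    fun ε hε => ?_, hint0, ?_⟩
  · have hi := (hint ε hε).congr (smoothingIntegrand_diracInv_ae_eq hD hm ε hp1 hp2).symm
    have hc : Continuous (smoothing m ε (diracInv hD hm (hp2.toLp p))) := by
      have h : Continuous (𝓕 (smoothingIntegrand m ε (diracInv hD hm (hp2.toLp p)))) :=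
        VectorFourier.fourierIntegral_continuous
          Real.continuous_fourierChar (innerSL ℝ).continuous₂ hi
      exact (h.comp continuous_neg).congr fun x => (Real.fourierInv_eq_fourier_neg _ _).symm
    have h0 : smoothing m ε (diracInv hD hm (hp2.toLp p)) 0
        = ∫ ξ, kgSymbol m ξ ^ (-ε) • matAct (diracSymbol α β m ξ)⁻¹ (𝓕 p ξ) := by
      rw [← integral_congr_ae (smoothingIntegrand_diracInv_ae_eq hD hm ε hp1 hp2), smoothing,
        Real.fourierInv_eq']
      simp
    rw [← hval ε hε, ← h0]
    exact hc.tendsto 0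
  · have hlim : Tendsto (fun ε : ℝ => ∫ ξ, kgSymbol m ξ ^ (-ε) • (kgSymbol m ξ)⁻¹ • 𝓕 p ξ)
        (𝓝[>] 0) (𝓝 (∫ ξ, (kgSymbol m ξ)⁻¹ • 𝓕 p ξ)) := by
      refine tendsto_integral_filter_of_dominated_convergence
        (fun ξ => (1 + (m ^ 2)⁻¹) * ‖(kgSymbol m ξ)⁻¹ • 𝓕 p ξ‖)
        (Eventually.of_forall fun ε => ((hrc _).smul (hic.smul hFc)).aestronglyMeasurable) ?_
        (hint0.norm.const_mul _) (Eventually.of_forall fun ξ => ?_)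
      · filter_upwards [Ioo_mem_nhdsGT (zero_lt_one' ℝ)] with ε hε
        refine Eventually.of_forall fun ξ => ?_
        rw [norm_smul, Real.norm_of_nonneg (Real.rpow_nonneg (hpos ξ).le _)]
        refine mul_le_mul_of_nonneg_right ?_ (norm_nonneg _)
        have hm2 : m ^ 2 ≤ kgSymbol m ξ := by
          unfold kgSymbol; nlinarith [sq_nonneg (2 * π * ‖ξ‖)]
        -- the power is at most `1` where the symbol exceeds `1`, and at most its inverse elsewhere
        rcases le_total 1 (kgSymbol m ξ) with h1 | h1
        · have h2 := Real.rpow_le_one_of_one_le_of_nonpos h1 (by linarith [hε.1] : -ε ≤ 0)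
          have : 0 ≤ (m ^ 2)⁻¹ := by positivity
          linarith
        · have h2 := Real.rpow_le_rpow_of_exponent_ge (hpos ξ) h1
            (by linarith [hε.2] : (-1 : ℝ) ≤ -ε)
          rw [Real.rpow_neg_one] at h2
          have h3 := inv_anti₀ (by positivity) hm2
          linarith
      · have h1 : Tendsto (fun ε : ℝ => kgSymbol m ξ ^ (-ε)) (𝓝[>] 0) (𝓝 1) := by
          have h2 : Continuous fun ε : ℝ => kgSymbol m ξ ^ (-ε) :=
            (Real.continuous_const_rpow (hpos ξ).ne').comp continuous_neg
          have h3 := (h2.tendsto 0).mono_left (nhdsWithin_le_nhds (s := Ioi 0))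
          simpa using h3
        simpa using h1.smul_const ((kgSymbol m ξ)⁻¹ • 𝓕 p ξ)
    exact (((matAct β).continuous.tendsto _).comp hlim).const_smul m

/-! ### Evaluation of the limit -/

/-- The field `pS` as a radial function, with the source extended continuously to all times. The
kernels agree off the light cone `s = |x|`, where the quotient in `pS` takes the junk value `0`. -/
theorem pS_eq_kgProfile {m : ℝ} (hm : 0 < m) (ζ : ℝ → Spinor) {t : ℝ} (ht : 0 ≤ t) :
    pS m ζ t = fun x : Space3 => kgProfile m (fun u => timeDeriv ζ (max u 0)) t ‖x‖ := by
  funext x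
  unfold pS kgProfile
  congr 1
  · rcases le_or_gt ‖x‖ t with h | h
    · simp only [max_eq_left (sub_nonneg.2 h)]
    · simp [heaviside_of_neg (by linarith : t - ‖x‖ < 0)]
  · congr 1
    refine intervalIntegral.integral_congr_ae ?_
    have hne : ∀ᵐ s : ℝ, s ≠ ‖x‖ := compl_mem_ae_iff.2 (measure_singleton _)
    filter_upwards [hne] with s hs hst
    rw [uIoc_of_le ht] at hst
    simp only [max_eq_left (sub_nonneg.2 hst.2)]
    congr 1
    rcases lt_or_gt_of_ne hs with h | h
    · simp [heaviside_of_neg (by linarith : s - ‖x‖ < 0)]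
    · have hpos : 0 < s ^ 2 - ‖x‖ ^ 2 := by nlinarith [norm_nonneg x]
      have hw : √(s ^ 2 - ‖x‖ ^ 2) ≠ 0 := (Real.sqrt_pos.2 hpos).ne'
      have e : (m * √(s ^ 2 - ‖x‖ ^ 2) / 2) ^ 2 = (m / 2) ^ 2 * (s ^ 2 - ‖x‖ ^ 2) := by
        rw [div_pow, div_pow, mul_pow, Real.sq_sqrt hpos.le]; ring
      rw [besselJ_one_eq, e]
      field_simp

/-- `u ↦ u ∫_u^∞ J₁(v)/v dv - J₀(u)` is a primitive of `u ↦ ∫_u^∞ J₁(v)/v dv`. -/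
theorem hasDerivAt_mul_besselMean_sub (u : ℝ) :
    HasDerivAt (fun u => u * besselMean u - besselJ 0 u) (besselMean u) u := by
  refine (((hasDerivAt_id u).mul (hasDerivAt_besselMean u)).sub
    (hasDerivAt_besselJ_zero u)).congr_deriv ?_
  rw [besselJ_one_eq]
  simp
  ring

/-- Integration by parts in time, which passes from the source `ζ̇` to `ζ`. -/
theorem integral_besselJ_sub_smul_timeDeriv {m : ℝ} (hm : 0 < m) {ζ : ℝ → Spinor}
    (hζ : ContDiffOn ℝ 1 ζ (Ici 0)) {t : ℝ} (ht : 0 ≤ t) :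
    ∫ s in (0 : ℝ)..t, (besselJ 0 (m * s) - m * s * besselTail (m * s)) •
        timeDeriv ζ (max (t - s) 0)
      = (m * t * besselTail (m * t) - besselJ 0 (m * t)) • ζ 0 + ζ t
        - m • ∫ s in (0 : ℝ)..t, besselTail (m * s) • ζ (t - s) := by
  have hMc : Continuous besselMean :=
    continuous_iff_continuousAt.2 fun u => (hasDerivAt_besselMean u).continuousAt
  have hJc := continuous_besselJ_zero
  have hgc : ContinuousOn (timeDeriv ζ) (Ici 0) :=
    hζ.continuousOn_derivWithin (uniqueDiffOn_Ici 0) le_rfl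
  have hg : Continuous fun s => timeDeriv ζ (max (t - s) 0) :=
    hgc.comp_continuous (by fun_prop) fun s => mem_Ici.2 (le_max_right _ _)
  have hz : ContinuousOn (fun s => ζ (t - s)) (Icc 0 t) :=
    hζ.continuousOn.comp (by fun_prop) fun s hs => sub_nonneg.2 hs.2
  have hz' : ContinuousOn (fun s => ζ (t - s)) (uIcc 0 t) := by rwa [uIcc_of_le ht]
  have hd : ∀ s ∈ Ioo 0 t, HasDerivAt
      (fun s => (m * s * besselMean (m * s) - besselJ 0 (m * s)) • ζ (t - s))
      ((m * besselMean (m * s)) • ζ (t - s) + (besselJ 0 (m * s) - m * s * besselMean (m * s)) •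
        timeDeriv ζ (max (t - s) 0)) s := by
    intro s hs
    have hts : 0 < t - s := sub_pos.2 hs.2
    have h1 : HasDerivAt ζ (timeDeriv ζ (t - s)) (t - s) :=
      ((hζ.differentiableOn one_ne_zero (t - s) hts.le).hasDerivWithinAt).hasDerivAt
        (Ici_mem_nhds hts)
    have h2 := h1.scomp s ((hasDerivAt_id s).const_sub t)
    have h3 := (hasDerivAt_mul_besselMean_sub (m * s)).comp s ((hasDerivAt_id s).const_mul m)
    refine (h3.smul h2).congr_deriv ?_
    rw [max_eq_left hts.le]
    simp only [Function.comp_apply]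
    module
  have hi1 : IntervalIntegrable (fun s => (m * besselMean (m * s)) • ζ (t - s)) volume 0 t :=
    ((by fun_prop : Continuous fun s => m * besselMean (m * s)).continuousOn.smul
      hz').intervalIntegrable
  have hi2 : IntervalIntegrable (fun s => (besselJ 0 (m * s) - m * s * besselMean (m * s)) •
      timeDeriv ζ (max (t - s) 0)) volume 0 t :=
    Continuous.intervalIntegrable (by fun_prop) _ _
  have h := intervalIntegral.integral_eq_sub_of_hasDerivAt_of_le ht
    ((by fun_prop : Continuous fun s =>
      m * s * besselMean (m * s) - besselJ 0 (m * s)).continuousOn.smul hz) hd (hi1.add hi2)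
  rw [intervalIntegral.integral_add hi1 hi2] at h
  have e1 : ∫ s in (0 : ℝ)..t, (besselJ 0 (m * s) - m * s * besselTail (m * s)) •
        timeDeriv ζ (max (t - s) 0)
      = ∫ s in (0 : ℝ)..t, (besselJ 0 (m * s) - m * s * besselMean (m * s)) •
        timeDeriv ζ (max (t - s) 0) := by
    refine intervalIntegral.integral_congr fun s hs => ?_
    rw [uIcc_of_le ht] at hs
    simp only [besselTail_eq_besselMean (mul_nonneg hm.le hs.1)]
  have e2 : m • ∫ s in (0 : ℝ)..t, besselTail (m * s) • ζ (t - s)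
      = ∫ s in (0 : ℝ)..t, (m * besselMean (m * s)) • ζ (t - s) := by
    rw [← intervalIntegral.integral_smul]
    refine intervalIntegral.integral_congr fun s hs => ?_
    rw [uIcc_of_le ht] at hs
    simp only [besselTail_eq_besselMean (mul_nonneg hm.le hs.1), smul_smul]
  rw [e1, e2, besselTail_eq_besselMean (mul_nonneg hm.le ht), eq_sub_iff_add_eq', h]
  simp [besselJ_zero_zero]

/-- The pairing of the Yukawa potential with the retarded field. -/
theorem integral_yukawa_smul_kgProfile {E : Type*} [NormedAddCommGroup E] [NormedSpace ℝ E]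
    [CompleteSpace E] {m : ℝ} (hm : 0 < m) {g : ℝ → E} (hg : Continuous g) {t : ℝ} (ht : 0 ≤ t) :
    ∫ x : Space3, yukawa m ‖x‖ • kgProfile m g t ‖x‖
      = (1 / (4 * π)) • ∫ s in (0 : ℝ)..t,
          (besselJ 0 (m * s) - m * s * besselTail (m * s)) • g (t - s) := by
  have hd : ∀ r : ℝ, HasDerivAt (fun r => Real.exp (-(m * r))) (-m * Real.exp (-(m * r))) r := by
    intro r
    refine (((hasDerivAt_id r).const_mul m).neg.exp).congr_deriv ?_
    simp
    ring
  have h := integral_smul_kgProfile m hg ht hd (by fun_prop)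
  have h2 : ∫ s in (0 : ℝ)..t, (besselJ 0 (m * s) - m * s * besselTail (m * s)) • g (t - s)
      = ∫ r in Ioi (0 : ℝ), (4 * π * r * Real.exp (-(m * r))) • kgProfile m g t r := by
    rw [h]
    refine intervalIntegral.integral_congr fun s hs => ?_
    rw [uIcc_of_le ht] at hs
    simp only [mul_assoc (-m), intervalIntegral.integral_const_mul,
      integral_exp_mul_besselEntire hm hs.1]
    congr 1
    simp
    ring
  rw [h2, ← integral_smul, integral_radial_space3 (fun r => yukawa m r • kgProfile m g t r)]
  refine setIntegral_congr_fun measurableSet_Ioi fun r hr => ?_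
  have hr : r ≠ 0 := ne_of_gt hr
  simp only [smul_smul, yukawa, neg_mul]
  congr 1
  field_simp

theorem fourier_kgProfile_norm_neg {E : Type*} [NormedAddCommGroup E] [NormedSpace ℂ E]
    [CompleteSpace E] {m : ℝ} (hm : 0 < m) {g : ℝ → E} (hg : Continuous g) {t : ℝ} (ht : 0 ≤ t)
    (ξ : Space3) :
    𝓕 (fun x : Space3 => kgProfile m g t ‖x‖) (-ξ)
      = 𝓕 (fun x : Space3 => kgProfile m g t ‖x‖) ξ := by
  rcases eq_or_ne ξ 0 with rfl | hξ
  · rw [neg_zero]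
  · rw [fourier_kgProfile_norm hm hg ht hξ, fourier_kgProfile_norm hm hg ht (neg_ne_zero.2 hξ)]
    simp [kgSymbol]

end

theorem proposition4p2
    {α : Fin 3 → Matrix (Fin 4) (Fin 4) ℂ} {β : Matrix (Fin 4) (Fin 4) ℂ}
    (hD : IsDiracMatrices α β) {m : ℝ} (hm : 0 < m)
    (ζ : ℝ → Spinor) (hζ : ContDiffOn ℝ 1 ζ (Ici 0)) (hζ2 : SecondDerivL2Loc ζ)
    (t : ℝ) (ht : 0 < t) :
    IntegrableOn (fun u : ℝ => besselJ 1 u / u) (Ioi 0) ∧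
    ∃ hp : MemLp (pS m ζ t) 2 (volume : Measure Space3),
      (∀ ε : ℝ, 0 < ε →
        Integrable (smoothingIntegrand m ε (diracInv hD hm (hp.toLp (pS m ζ t))))) ∧
      ∃ L : ℝ → Spinor,
        (∀ ε : ℝ, 0 < ε →
          Tendsto (smoothing m ε (diracInv hD hm (hp.toLp (pS m ζ t))))
            (𝓝[≠] (0 : Space3)) (𝓝 (L ε))) ∧
        Tendsto L (𝓝[>] (0 : ℝ))
          (𝓝 ((m / (4 * π)) • matAct β
            ((m * t * besselTail (m * t) - besselJ 0 (m * t)) • ζ 0 + ζ t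
              - m • ∫ s in (0 : ℝ)..t, besselTail (m * s) • ζ (t - s)))) := by
  refine ⟨integrableOn_besselJ_one_div, ?_⟩
  set g : ℝ → Spinor := fun u => timeDeriv ζ (max u 0) with hgdef
  have hgc : ContinuousOn (timeDeriv ζ) (Ici 0) :=
    hζ.continuousOn_derivWithin (uniqueDiffOn_Ici 0) le_rfl
  have hg : Continuous g := hgc.comp_continuous (by fun_prop) fun s => mem_Ici.2 (le_max_right _ _)
  obtain ⟨η, hη2, hη⟩ := hζ2
  have hηi : IntervalIntegrable η volume 0 t := by
    rw [intervalIntegrable_iff_integrableOn_Icc_of_le ht.le]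
    exact (hη2 t ht).integrable (by norm_num)
  have hgη : ∀ u ∈ Icc 0 t, g u = g 0 + ∫ s in (0 : ℝ)..u, η s := by
    intro u hu
    simp only [hgdef, max_eq_left hu.1, max_self]
    exact hη u hu.1
  obtain ⟨C, hC0, hC⟩ := exists_norm_integral_sin_smul_le ht.le hηi hgη
  rw [pS_eq_kgProfile hm ζ ht.le]
  have hp1 := integrable_kgProfile_norm m hg ht.le
  have hp2 := memLp_kgProfile_norm m hg ht.le
  have hbound : ∀ᵐ ξ, ‖𝓕 (fun x : Space3 => kgProfile m g t ‖x‖) ξ‖ ≤ C * (kgSymbol m ξ)⁻¹ := by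
    filter_upwards [ae_ne_zero_space3] with ξ hξ
    have hpos := kgSymbol_pos hm ξ
    rw [fourier_kgProfile_norm hm hg ht.le hξ]
    have h := hC _ (Real.sqrt_pos.2 hpos)
    rwa [Real.sq_sqrt hpos.le, div_eq_mul_inv] at h
  obtain ⟨h1, h2, h3, h4⟩ := tendsto_smoothing_diracInv hD hm hp1 hp2
    (fourier_kgProfile_norm_neg hm hg ht.le) hbound
  refine ⟨hp2, h1, _, fun ε hε => (h2 ε hε).mono_left nhdsWithin_le_nhds, ?_⟩
  rw [integral_kgSymbol_inv_smul_fourier hm hp1 hp2 h3, integral_yukawa_smul_kgProfile hm hg ht.le,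
    integral_besselJ_sub_smul_timeDeriv hm hζ ht.le, ← Complex.coe_smul (1 / (4 * π)), map_smul,
    Complex.coe_smul, smul_smul, mul_one_div] at h4
  exact h4
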